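/- Let $x\in\mathbb{C}$ be a root of unity and let $q\ge 1$ be an integer with $(q,x)\neq(1,1)$. For integers $p\ge 1$ and $z\in\{x,x^{-1}\}$ put $$\mathrm{Li}_p(z;\tfrac12):=\sum_{n=1}^\infty\frac{z^n}{(n-\frac12)^p}\qquad((p,z)\neq(1,1)).$$ Let $Y_n(x_1,\ldots,x_n)$ be the exponential complete Bell polynomials, defined by $\exp\left(\sum_{k\ge1}x_k\frac{t^k}{k!}\right)=\sum_{n\ge0}Y_n(x_1,\ldots,x_n)\frac{t^n}{n!}$, and for $n\ge 0$ let $$C_n:=Y_n\big(0,1!\,\zeta(2),-2!\,\zeta(3),\ldots,(-1)^n(n-1)!\,\zeta(n)\big),\qquad D_n:=Y_n\big(0,-1!\,\zeta(2),2!\,\zeta(3),\ldots,(-1)^{n-1}(n-1)!\,\zeta(n)\big),$$ where $\zeta$ is the Riemann zeta function and the first argument (index $k=1$) is $0$. Then $$\sum_{n=1}^\infty\frac{n}{(n-\frac12)^q}\frac{\binom{2n}{n}}{4^n}x^{1-n}=\sum_{\substack{k_1+\cdots+k_5=q-1\\ k_j\ge0}}\frac{C_{k_1}C_{k_2}D_{k_3}2^{k_3+k_4}}{k_1!\,k_2!\,k_3!\,k_4!}\,\frac{\log^{k_4}(2)}{\pi}\Big(x\,\mathrm{Li}_{k_5+1}(x^{-1};\tfrac12)-(-1)^{k_5}\mathrm{Li}_{k_5+1}(x;\tfrac12)\Big)$$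 $$\qquad+\frac{(-1)^q}{\pi}\Big(\mathrm{Li}_1(x;\tfrac12)-x\,\mathrm{Li}_1(x^{-1};\tfrac12)\Big)\sum_{n=1}^\infty\frac{\binom{2n}{n}}{n^{q-1}4^n}x^n.$$ All infinite series are limits of their partial sums taken in increasing order of $n$, and all of them converge, with one exception: for $x=1$ (hence $q\ge2$) the two series $\mathrm{Li}_1(1;\tfrac12)$ diverge, and the difference $x\,\mathrm{Li}_1(x^{-1};\tfrac12)-\mathrm{Li}_1(x;\tfrac12)$ is then understood as $0$, the limit of the differences of the partial sums. -/

import Mathlib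

open Filter Topology

noncomputable section

namespace AperySeries

/-- The series `∑_{n ≥ 1} f n` converges, possibly only conditionally: its partial sums, taken in
the order of increasing `n`, have a limit. -/
def Converges (f : ℕ → ℂ) : Prop :=
  ∃ s : ℂ, Tendsto (fun N : ℕ => ∑ n ∈ Finset.Icc 1 N, f n) atTop (𝓝 s)

/-- The sum `∑_{n = 1}^∞ f n`, i.e. the limit of the partial sums `∑_{n = 1}^N f n`
(meaningful when `Converges f`). -/
def seriesSum (f : ℕ → ℂ) : ℂ :=
  limUnder atTop (fun N : ℕ => ∑ n ∈ Finset.Icc 1 N, f n)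

/-- The `n`-th term `x ^ n / (n + c - 1) ^ p` of the cyclotomic Hurwitz zeta function
`Li_p(x; c)`. -/
def hurwitzTerm (p : ℕ) (x c : ℂ) (n : ℕ) : ℂ :=
  x ^ n / ((n : ℂ) + c - 1) ^ p

/-- The cyclotomic Hurwitz zeta function: with `c = b + 1`,
`Li_p(x; b + 1) = ∑_{n = 1}^∞ x ^ n / (n + b) ^ p`, for `(p, x) ≠ (1, 1)`. -/
def hurwitzLi (p : ℕ) (x c : ℂ) : ℂ :=
  seriesSum (hurwitzTerm p x c)

/-- The generating series `∑_{k ≥ 1} x_k t ^ k / k!` (the value `x 0` is not used). -/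
def egf (x : ℕ → ℂ) : PowerSeries ℂ :=
  PowerSeries.mk fun k => if k = 0 then 0 else x k / (k.factorial : ℂ)

/-- The exponential complete Bell polynomial `Y_n(x_1, …, x_n)`, defined by
`exp (∑_{k ≥ 1} x_k t ^ k / k!) = ∑_{n ≥ 0} Y_n(x_1, …, x_n) t ^ n / n!`
as formal power series in `t`. -/
def bellY (n : ℕ) (x : ℕ → ℂ) : ℂ :=
  (n.factorial : ℂ) * PowerSeries.coeff n ((PowerSeries.exp ℂ).subst (egf x))

/-- `C_n = Y_n(0, 1! ζ(2), -2! ζ(3), …, (-1)^n (n-1)! ζ(n))`. -/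
def bellC (n : ℕ) : ℂ :=
  bellY n fun k => if k = 1 then 0 else (-1) ^ k * ((k - 1).factorial : ℂ) * riemannZeta k

/-- `D_n = Y_n(0, -1! ζ(2), 2! ζ(3), …, (-1)^(n-1) (n-1)! ζ(n))`. -/
def bellD (n : ℕ) : ℂ :=
  bellY n fun k => if k = 1 then 0 else (-1) ^ (k - 1) * ((k - 1).factorial : ℂ) * riemannZeta k

/-- The `n`-th term `binom(2n, n) x ^ n / (n ^ (q - 1) 4 ^ n)`. -/
def aperyTerm (q : ℕ) (x : ℂ) (n : ℕ) : ℂ :=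
  ((2 * n).choose n : ℂ) * x ^ n / ((n : ℂ) ^ (q - 1) * 4 ^ n)

/-- The `n`-th term `n / (n - 1/2) ^ q * binom(2n, n) / 4 ^ n * x ^ (1 - n)`, with `1 - n` an
integer exponent. -/
def halfAperyTerm (q : ℕ) (x : ℂ) (n : ℕ) : ℂ :=
  (n : ℂ) / ((n : ℂ) - 1 / 2) ^ q * (((2 * n).choose n : ℂ) / 4 ^ n) * x ^ (1 - (n : ℤ))

end AperySeries

end

/-! ### Mellin transform of `(1 + c v) ^ (-b)` and its folding to the unit interval. -/

noncomputable section
namespace AperySeries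
open Complex MeasureTheory Set

/-! Write c_n = binom(2n, n) / 4^n. Since (n+1) c_{n+1} = (n+1/2) c_n, an index shift turns the left
side into ∑_{n≥0} c_n x^{-n} / (n+1/2)^{q-1}. For q ≥ 2 these sums are Taylor coefficients at t = 0
of `halfAperyFun x t`, so the evaluations for all q ≥ 2 amount to one identity between functions of
t.

That identity comes from the Mellin transform ∫_0^∞ v^{s-1} (1 + c v)^{-b} dv = c^{-s} B(s, b-s) at
c = -x. Cutting at v = 1 and inverting v on the outer piece gives two integrals over (0, 1), in x
and in x⁻¹, which expand into series (`integral_mellinKernel_Ioo`). The choice b = 1/2, s = t gives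
1/t + `aperyFun x t` + (-x)^{-1/2} `halfAperyFun x t` = (-x)^{-t} Γ(t) Γ(1/2-t) / √π, and b = 1, s =
1/2 + t gives `bilateralFun x t` = (-x)^{1/2-t} Γ(1/2+t) Γ(1/2-t), whose Taylor coefficients are the
combinations of Li in the statement. In particular `bilateralCoeff x 0` = π (-x)^{1/2}.

Eliminating (-x)^{-t} Γ(1/2-t) leaves the factor Γ(1+t) √π / Γ(t+1/2), which is 4^t Γ(1+t)² /
Γ(1+2t) by duplication. As log Γ(1+t) = -γ t + ∑_{k≥2} (-1)^k ζ(k) t^k / k, the terms in γ cancel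
and the factor expands into C, C, D and powers of log 2. The coefficient of t^{q-1} is the theorem
for q ≥ 2.

Two cases stand apart. For x = 1 the point -x lies on the cut, and the identity follows from a beta
integral, the partial fractions of the cotangent and the reflection formula. For q = 1 both series
of central binomials converge only conditionally and are summed by Abel's theorem. -/

lemma one_add_mul_mem_slitPlane {c : ℂ} (hc : c ∈ slitPlane) {v : ℝ} (hv : 0 ≤ v) :
    1 + c * v ∈ slitPlane := by
  rw [mem_slitPlane_iff] at hc ⊢
  simp only [add_re, one_re, mul_re, ofReal_re, ofReal_im, mul_zero, sub_zero, add_im, one_im,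
    mul_im, zero_add]
  rcases hc with h | h
  · left; positivity
  · rcases hv.eq_or_lt with rfl | hv
    · left; simp
    · right; simpa using ⟨h, hv.ne'⟩

/-- On a neighbourhood of a point of the slit plane, `‖1 + c v‖` is bounded below by a multiple
of `1 + v`, uniformly in `v ≥ 0`. -/
lemma exists_norm_one_add_mul_ge {c₀ : ℂ} (hc₀ : c₀ ∈ slitPlane) :
    ∃ δ > 0, ∀ c ∈ Metric.ball c₀ δ, c ∈ slitPlane ∧
      ∀ v : ℝ, 0 ≤ v → δ * (1 + v) ≤ ‖1 + c * v‖ := by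
  obtain ⟨ε, hε, hball⟩ := Metric.isOpen_iff.1 isOpen_slitPlane c₀ hc₀
  -- Dividing `1 + c₀ v` by `1 + v` gives the point `(1 - l) + l c₀` with `l = v / (1 + v)`. The
  -- segment from 1 to `c₀` is compact and avoids 0, so its distance `m` to 0 is positive. Half of
  -- `m` is given up below to let `c₀` vary.
  obtain ⟨l, hl, hmin⟩ := (isCompact_Icc (a := (0 : ℝ)) (b := 1)).exists_isMinOn
    ⟨0, by simp⟩ (f := fun l : ℝ => ‖(1 - l : ℂ) + l * c₀‖) (by fun_prop)
  have hpos : 0 < ‖(1 - l : ℂ) + l * c₀‖ := by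
    rw [norm_pos_iff]
    intro h
    rcases hl.2.eq_or_lt with h1 | h1
    · rw [h1] at h
      simp only [ofReal_one, sub_self, one_mul, zero_add] at h
      exact slitPlane_ne_zero hc₀ h
    · have h2 : (0 : ℝ) < 1 - l := by linarith
      have := one_add_mul_mem_slitPlane hc₀ (v := l / (1 - l)) (div_nonneg hl.1 h2.le)
      apply slitPlane_ne_zero this
      have h3 : (1 - l : ℂ) ≠ 0 := by exact_mod_cast h2.ne'
      push_cast
      field_simp
      rw [mul_comm c₀, h, mul_zero]
  set m := ‖(1 - l : ℂ) + l * c₀‖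
  refine ⟨min ε (m / 2), by positivity, fun c hc => ⟨hball ?_, fun v hv => ?_⟩⟩
  · exact Metric.ball_subset_ball (min_le_left _ _) hc
  · have h1v : (0 : ℝ) < 1 + v := by linarith
    have hmem : v / (1 + v) ∈ Icc (0 : ℝ) 1 :=
      ⟨by positivity, by rw [div_le_one h1v]; linarith⟩
    have h1 : m ≤ ‖(1 - (v / (1 + v) : ℝ) : ℂ) + (v / (1 + v) : ℝ) * c₀‖ := hmin hmem
    have h3 : (1 + v : ℂ) ≠ 0 := by exact_mod_cast h1v.ne'
    have h2 : (1 - (v / (1 + v) : ℝ) : ℂ) + (v / (1 + v) : ℝ) * c₀ = (1 + c₀ * v) / ((1 + v : ℝ) : ℂ) := by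
      push_cast
      field_simp
      ring
    rw [h2, norm_div, norm_real, Real.norm_of_nonneg h1v.le, le_div_iff₀ h1v] at h1
    have h4 : ‖(c₀ - c) * v‖ ≤ m / 2 * (1 + v) := by
      rw [norm_mul, norm_real, Real.norm_of_nonneg hv, ← dist_eq_norm, dist_comm]
      have := (Metric.mem_ball.1 hc).le.trans (min_le_right ε (m / 2))
      gcongr
      linarith
    have h5 : ‖1 + c₀ * v‖ ≤ ‖1 + c * v‖ + ‖(c₀ - c) * v‖ := by
      refine le_trans (le_of_eq ?_) (norm_add_le _ _)
      congr 1; ring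
    have h6 : min ε (m / 2) * (1 + v) ≤ m / 2 * (1 + v) := by gcongr; exact min_le_right _ _
    linarith

lemma norm_cpow_ofReal {w : ℂ} (hw : w ≠ 0) (b : ℝ) : ‖w ^ (b : ℂ)‖ = ‖w‖ ^ b := by
  rw [norm_cpow_of_ne_zero hw]; simp

lemma image_div_one_add_Ioi : (fun v : ℝ => v / (1 + v)) '' Ioi 0 = Ioo 0 1 := by
  ext u
  simp only [mem_image, mem_Ioi, mem_Ioo]
  constructor
  · rintro ⟨v, hv, rfl⟩
    exact ⟨by positivity, by rw [div_lt_one (by positivity)]; linarith⟩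
  · rintro ⟨h0, h1⟩
    have : 0 < 1 - u := by linarith
    exact ⟨u / (1 - u), by positivity, by field_simp; ring⟩

lemma injOn_div_one_add : InjOn (fun v : ℝ => v / (1 + v)) (Ioi 0) := by
  intro a ha b hb h
  have ha : (0 : ℝ) < a := ha
  have hb : (0 : ℝ) < b := hb
  simp only at h
  rw [div_eq_div_iff (by positivity) (by positivity)] at h
  linarith

lemma hasDerivWithinAt_div_one_add (v : ℝ) (hv : v ∈ Ioi (0 : ℝ)) :
    HasDerivWithinAt (fun v : ℝ => v / (1 + v)) (1 / (1 + v) ^ 2) (Ioi 0) v := by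
  have hv : (0 : ℝ) < v := hv
  have := ((hasDerivAt_id v).div ((hasDerivAt_id v).const_add 1) (by simp; positivity))
  convert! this.hasDerivWithinAt using 1
  simp

/-- The substitution u = v / (1 + v) has 1 - u = 1 / (1 + v) and Jacobian (1 + v)^{-2}; it carries
the beta integral on (0, 1) to the Mellin integral on the half-line. -/
lemma beta_density_comp {s b v : ℝ} (hv : 0 < v) :
    |1 / (1 + v) ^ 2| • ((v / (1 + v)) ^ (s - 1) * (1 - v / (1 + v)) ^ (b - s - 1)) =
      v ^ (s - 1) * (1 + v) ^ (-b) := by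
  have h1 : 0 < 1 + v := by linarith
  have h2 : 1 - v / (1 + v) = (1 + v)⁻¹ := by field_simp; ring
  rw [h2, abs_of_pos (by positivity), Real.div_rpow hv.le h1.le, Real.inv_rpow h1.le,
    ← Real.rpow_neg h1.le, smul_eq_mul, one_div, ← Real.rpow_natCast, ← Real.rpow_neg h1.le,
    div_eq_mul_inv, ← Real.rpow_neg h1.le]
  have : (1 + v) ^ (-b) = (1 + v) ^ (-((2 : ℕ) : ℝ)) * (1 + v) ^ (-(s - 1)) *
      (1 + v) ^ (-(b - s - 1)) := by
    rw [← Real.rpow_add h1, ← Real.rpow_add h1]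
    congr 1; push_cast; ring
  rw [this]; ring

lemma betaIntegral_ofReal {s t : ℝ} :
    betaIntegral s t = ∫ u in Ioo (0 : ℝ) 1, ((u ^ (s - 1) * (1 - u) ^ (t - 1) : ℝ) : ℂ) := by
  rw [betaIntegral, intervalIntegral.integral_of_le zero_le_one, integral_Ioc_eq_integral_Ioo]
  refine setIntegral_congr_fun measurableSet_Ioo fun u hu => ?_
  rw [ofReal_mul, ofReal_cpow hu.1.le, ofReal_cpow (by linarith [hu.2])]
  push_cast; rfl

lemma integrableOn_beta_Ioo {s t : ℝ} (hs : 0 < s) (ht : 0 < t) :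
    IntegrableOn (fun u : ℝ => u ^ (s - 1) * (1 - u) ^ (t - 1)) (Ioo 0 1) := by
  have h := betaIntegral_convergent (u := s) (v := t) (by simpa) (by simpa)
  rw [intervalIntegrable_iff_integrableOn_Ioo_of_le zero_le_one] at h
  have h2 := h.norm
  refine IntegrableOn.congr_fun h2 (fun u hu => ?_) measurableSet_Ioo
  have h1 : 0 < 1 - u := by linarith [hu.2]
  rw [norm_mul, show (1 - (u : ℂ)) = ((1 - u : ℝ) : ℂ) by push_cast; rfl,
    show ((s : ℂ) - 1) = ((s - 1 : ℝ) : ℂ) by push_cast; rfl,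
    show ((t : ℂ) - 1) = ((t - 1 : ℝ) : ℂ) by push_cast; rfl,
    norm_cpow_ofReal (by exact_mod_cast hu.1.ne'), norm_cpow_ofReal (by exact_mod_cast h1.ne'),
    norm_real, norm_real, Real.norm_of_nonneg hu.1.le, Real.norm_of_nonneg h1.le]

lemma integrableOn_mellin_one_add {s b : ℝ} (hs : 0 < s) (hb : s < b) :
    IntegrableOn (fun v : ℝ => v ^ (s - 1) * (1 + v) ^ (-b)) (Ioi 0) := by
  have h := integrableOn_beta_Ioo hs (t := b - s) (by linarith)
  rw [← image_div_one_add_Ioi, integrableOn_image_iff_integrableOn_abs_deriv_smul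
    measurableSet_Ioi hasDerivWithinAt_div_one_add injOn_div_one_add] at h
  exact h.congr_fun (fun v hv => beta_density_comp hv) measurableSet_Ioi

lemma integral_mellin_one_add {s b : ℝ} :
    ∫ v in Ioi (0 : ℝ), ((v ^ (s - 1) * (1 + v) ^ (-b) : ℝ) : ℂ) =
      betaIntegral s ((b - s : ℝ) : ℂ) := by
  rw [betaIntegral_ofReal, ← image_div_one_add_Ioi, integral_image_eq_integral_abs_deriv_smul
    measurableSet_Ioi hasDerivWithinAt_div_one_add injOn_div_one_add]
  refine setIntegral_congr_fun measurableSet_Ioi fun v hv => ?_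
  rw [← beta_density_comp hv]
  simp only [smul_eq_mul, ofReal_mul, real_smul]

/-- The integrand of the Mellin transform of `(1 + c v) ^ (-b)`. -/
def mellinKernel (b s : ℝ) (c : ℂ) (v : ℝ) : ℂ := ((v ^ (s - 1) : ℝ) : ℂ) * (1 + c * v) ^ (-b : ℂ)

lemma continuousOn_mellinKernel {b s : ℝ} {c : ℂ} (hc : c ∈ slitPlane) :
    ContinuousOn (mellinKernel b s c) (Ioi 0) := by
  intro v hv
  have hv : (0 : ℝ) < v := hv
  apply ContinuousAt.continuousWithinAt
  unfold mellinKernel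
  apply ContinuousAt.mul
  · exact continuous_ofReal.continuousAt.comp
      (Real.continuousAt_rpow_const v (s - 1) (Or.inl hv.ne'))
  · exact ContinuousAt.cpow (by fun_prop) continuousAt_const (one_add_mul_mem_slitPlane hc hv.le)

lemma norm_one_add_cpow_le {δ v b : ℝ} {c : ℂ} (hδ : 0 < δ) (hv : 0 ≤ v) (hb : 0 ≤ b)
    (h : δ * (1 + v) ≤ ‖1 + c * v‖) :
    ‖(1 + c * v) ^ (-b : ℂ)‖ ≤ δ ^ (-b) * (1 + v) ^ (-b) := by
  have h1 : 0 < δ * (1 + v) := by positivity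
  rw [show (-b : ℂ) = ((-b : ℝ) : ℂ) by push_cast; rfl,
    norm_cpow_ofReal (norm_pos_iff.1 (h1.trans_le h)), ← Real.mul_rpow hδ.le (by linarith)]
  exact Real.rpow_le_rpow_of_nonpos h1 h (by linarith)

lemma norm_mellinKernel_le {δ v b s : ℝ} {c : ℂ} (hδ : 0 < δ) (hv : 0 < v) (hb : 0 ≤ b)
    (h : δ * (1 + v) ≤ ‖1 + c * v‖) :
    ‖mellinKernel b s c v‖ ≤ δ ^ (-b) * (v ^ (s - 1) * (1 + v) ^ (-b)) := by
  rw [mellinKernel, norm_mul, norm_real, Real.norm_of_nonneg (by positivity)]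
  calc _ ≤ v ^ (s - 1) * (δ ^ (-b) * (1 + v) ^ (-b)) := by
        gcongr; exact norm_one_add_cpow_le hδ hv.le hb h
    _ = _ := by ring

lemma integrableOn_mellinKernel {b s : ℝ} {c : ℂ} (hs : 0 < s) (hb : s < b)
    (hc : c ∈ slitPlane) : IntegrableOn (mellinKernel b s c) (Ioi 0) := by
  obtain ⟨δ, hδ, h⟩ := exists_norm_one_add_mul_ge hc
  refine Integrable.mono' ((integrableOn_mellin_one_add hs hb).const_mul (δ ^ (-b)))
    ((continuousOn_mellinKernel hc).aestronglyMeasurable measurableSet_Ioi) ?_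
  filter_upwards [ae_restrict_mem measurableSet_Ioi] with v hv
  exact norm_mellinKernel_le hδ hv (by linarith)
    ((h c (Metric.mem_ball_self hδ)).2 v (le_of_lt hv))

/-- Differentiation under the integral sign. The derivative brings down -b v and raises b to b + 1;
since v (1 + v)^{-(b+1)} ≤ (1 + v)^{-b}, the integrable bound for the kernel itself, up to
constants, dominates uniformly on a small ball. -/
lemma differentiableOn_integral_mellinKernel {b s : ℝ} (hs : 0 < s) (hb : s < b) :
    DifferentiableOn ℂ (fun c => ∫ v in Ioi (0 : ℝ), mellinKernel b s c v) slitPlane := by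
  intro c₀ hc₀
  obtain ⟨δ, hδ, h⟩ := exists_norm_one_add_mul_ge hc₀
  have hb0 : 0 < b := hs.trans hb
  apply DifferentiableAt.differentiableWithinAt
  have key := hasDerivAt_integral_of_dominated_loc_of_deriv_le
    (μ := volume.restrict (Ioi (0 : ℝ))) (F := fun c v => mellinKernel b s c v) (x₀ := c₀)
    (s := Metric.ball c₀ δ)
    (F' := fun c v => ((-b : ℂ) * v) * mellinKernel (b + 1) s c v)
    (bound := fun v => b * (δ ^ (-(b + 1)) * (v ^ (s - 1) * (1 + v) ^ (-b))))
    (Metric.ball_mem_nhds _ hδ) ?_ (integrableOn_mellinKernel hs hb hc₀) ?_ ?_ ?_ ?_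
  · exact key.2.differentiableAt
  · filter_upwards [Metric.ball_mem_nhds _ hδ] with c hc
    exact (continuousOn_mellinKernel (h c hc).1).aestronglyMeasurable measurableSet_Ioi
  · refine ContinuousOn.aestronglyMeasurable ?_ measurableSet_Ioi
    exact ContinuousOn.mul (by fun_prop) (continuousOn_mellinKernel hc₀)
  · filter_upwards [ae_restrict_mem measurableSet_Ioi] with v hv c hc
    have hv : (0 : ℝ) < v := hv
    have h1 : 0 < 1 + v := by linarith
    rw [norm_mul, norm_mul, norm_neg, norm_real, norm_real, Real.norm_of_nonneg hb0.le,
      Real.norm_of_nonneg hv.le]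
    calc _ ≤ b * v * (δ ^ (-(b + 1)) * (v ^ (s - 1) * (1 + v) ^ (-(b + 1)))) := by
          gcongr
          exact norm_mellinKernel_le hδ hv (by linarith) ((h c hc).2 v hv.le)
      _ = b * (δ ^ (-(b + 1)) * (v ^ (s - 1) * (v * (1 + v) ^ (-(b + 1))))) := by ring
      _ ≤ _ := by
          gcongr
          calc _ ≤ (1 + v) * (1 + v) ^ (-(b + 1)) := by gcongr; linarith
            _ = (1 + v) ^ (-b) := by
              nth_rw 1 [← Real.rpow_one (1 + v)]
              rw [← Real.rpow_add h1]; congr 1; ring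
  · exact ((integrableOn_mellin_one_add hs hb).const_mul _).const_mul _
  · filter_upwards [ae_restrict_mem measurableSet_Ioi] with v hv c hc
    have hv : (0 : ℝ) < v := hv
    have h2 := one_add_mul_mem_slitPlane (h c hc).1 hv.le
    have h3 : HasDerivAt (fun c : ℂ => 1 + c * v) (v : ℂ) c := by
      simpa using ((hasDerivAt_id c).mul_const (v : ℂ)).const_add 1
    have h4 := (h3.cpow_const (c := (-b : ℂ)) h2).const_mul ((v ^ (s - 1) : ℝ) : ℂ)
    convert! h4 using 1
    simp only [mellinKernel]
    rw [show (-((b + 1 : ℝ) : ℂ)) = -b - 1 by push_cast; ring]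
    ring

/-- For real c > 0 the rescaling v ↦ c v reduces to c = 1. This is the input for analytic
continuation in c. -/
lemma integral_mellinKernel_ofReal {b s c : ℝ} (hc : 0 < c) :
    ∫ v in Ioi (0 : ℝ), mellinKernel b s c v = (c : ℂ) ^ (-s : ℂ) *
      betaIntegral s ((b - s : ℝ) : ℂ) := by
  have h := integral_comp_mul_left_Ioi
    (fun v => ((c ^ (1 - s) : ℝ) : ℂ) * ((v ^ (s - 1) * (1 + v) ^ (-b) : ℝ) : ℂ)) 0 hc
  rw [mul_zero, integral_const_mul _ (fun v : ℝ => ((v ^ (s - 1) * (1 + v) ^ (-b) : ℝ) : ℂ)),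
    integral_mellin_one_add] at h
  have h2 : (c : ℂ) ^ (-s : ℂ) = c⁻¹ • ((c ^ (1 - s) : ℝ) : ℂ) := by
    rw [show (-s : ℂ) = ((-s : ℝ) : ℂ) by push_cast; rfl, ← ofReal_cpow hc.le, real_smul,
      ← ofReal_mul]
    congr 1
    rw [← Real.rpow_neg_one, ← Real.rpow_add hc]; congr 1; ring
  rw [h2, smul_mul_assoc, ← h]
  refine setIntegral_congr_fun measurableSet_Ioi fun v hv => ?_
  have hv : (0 : ℝ) < v := hv
  simp only [mellinKernel]
  rw [show (-b : ℂ) = ((-b : ℝ) : ℂ) by push_cast; rfl,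
    show (1 + (c : ℂ) * v) = ((1 + c * v : ℝ) : ℂ) by push_cast; rfl,
    ← ofReal_cpow (by positivity), ← ofReal_mul, ← ofReal_mul, Real.mul_rpow hc.le hv.le]
  congr 1
  have : c ^ (1 - s) * c ^ (s - 1) = 1 := by
    rw [← Real.rpow_add hc]; simp
  calc _ = (c ^ (1 - s) * c ^ (s - 1)) * (v ^ (s - 1) * (1 + c * v) ^ (-b)) := by
        rw [this, one_mul]
    _ = _ := by ring

/-- The Mellin transform of `(1 + c v) ^ (-b)` on the positive half-line. -/
lemma integral_mellinKernel {b s : ℝ} (hs : 0 < s) (hb : s < b) {c : ℂ} (hc : c ∈ slitPlane) :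
    ∫ v in Ioi (0 : ℝ), mellinKernel b s c v =
      c ^ (-s : ℂ) * betaIntegral s ((b - s : ℝ) : ℂ) := by
  have hf := (differentiableOn_integral_mellinKernel hs hb).analyticOnNhd isOpen_slitPlane
  have hg : AnalyticOnNhd ℂ (fun c : ℂ => c ^ (-s : ℂ) * betaIntegral s ((b - s : ℝ) : ℂ))
      slitPlane := by
    refine DifferentiableOn.analyticOnNhd (fun c hc => ?_) isOpen_slitPlane
    exact ((differentiableAt_id.cpow_const hc).mul_const _).differentiableWithinAt
  have hpre : IsPreconnected slitPlane := by
    have := starConvex_one_slitPlane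
    exact (this.isPathConnected one_mem_slitPlane).isConnected.isPreconnected
  refine hf.eqOn_of_preconnected_of_frequently_eq hg hpre one_mem_slitPlane ?_ hc
  -- Both sides are analytic on the connected slit plane and agree at the points 1 + 1/(n+1), which
  -- accumulate at 1; the identity theorem does the rest.
  have hu : Tendsto (fun n : ℕ => ((1 + 1 / ((n : ℝ) + 1) : ℝ) : ℂ)) atTop (𝓝[≠] 1) := by
    refine tendsto_nhdsWithin_iff.2 ⟨?_, Eventually.of_forall fun n => ?_⟩
    · have := (tendsto_one_div_add_atTop_nhds_zero_nat (𝕜 := ℝ)).const_add 1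
      rw [add_zero] at this
      exact_mod_cast (continuous_ofReal.tendsto 1).comp this
    · have : (1 : ℝ) + 1 / ((n : ℝ) + 1) ≠ 1 := by
        have : (0 : ℝ) < 1 / ((n : ℝ) + 1) := by positivity
        linarith
      simp only [mem_compl_iff, mem_singleton_iff]
      exact_mod_cast this
  refine hu.frequently (Eventually.of_forall fun n => ?_).frequently
  exact integral_mellinKernel_ofReal (by positivity)

/-- Principal powers are not multiplicative in general. Here `w` and `1 + w⁻¹` have imaginary parts
of opposite sign (or `w` is positive), so the sum of their arguments stays in (-π, π] and the
logarithms add. -/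
lemma one_add_inv_cpow {w : ℂ} (hw : w ∈ slitPlane) (b : ℂ) :
    (1 + w) ^ b = w ^ b * (1 + w⁻¹) ^ b := by
  have hw0 := slitPlane_ne_zero hw
  have h1w : 1 + w⁻¹ ≠ 0 := by
    intro h
    have h2 : w = -1 := by
      have : w + 1 = 0 := by
        have := congrArg (w * ·) h
        simpa [mul_add, hw0] using this
      linear_combination this
    rw [h2, mem_slitPlane_iff] at hw
    norm_num at hw
  have h1 : 1 + w = w * (1 + w⁻¹) := by field_simp; ring
  have him : (1 + w⁻¹).im = -w.im / normSq w := by simp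
  have hns : 0 < normSq w := normSq_pos.2 hw0
  have hlog : log (1 + w) = log w + log (1 + w⁻¹) := by
    rw [h1]
    refine (log_mul_eq_add_log_iff hw0 h1w).2 ?_
    rcases lt_trichotomy w.im 0 with h | h | h
    · have h3 : arg w < 0 := arg_neg_iff.2 h
      have h4 : 0 ≤ arg (1 + w⁻¹) := by
        rw [arg_nonneg_iff, him]; apply div_nonneg <;> linarith
      have := neg_pi_lt_arg w
      have := arg_le_pi (1 + w⁻¹)
      constructor <;> linarith
    · have hre : 0 < w.re := by
        rcases mem_slitPlane_iff.1 hw with h' | h'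
        · exact h'
        · exact absurd h h'
      have h3 : arg w = 0 := arg_eq_zero_iff.2 ⟨hre.le, h⟩
      rw [h3, zero_add]
      exact ⟨neg_pi_lt_arg _, arg_le_pi _⟩
    · have h3 : 0 ≤ arg w := arg_nonneg_iff.2 h.le
      have h4 : arg (1 + w⁻¹) < 0 := by
        rw [arg_neg_iff, him]; apply div_neg_of_neg_of_pos <;> linarith
      have := neg_pi_lt_arg (1 + w⁻¹)
      have := arg_le_pi w
      constructor <;> linarith
  rw [cpow_def_of_ne_zero (by rw [h1]; exact mul_ne_zero hw0 h1w), cpow_def_of_ne_zero hw0,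
    cpow_def_of_ne_zero h1w, hlog, ← exp_add]
  ring_nf

lemma ofReal_mul_mem_slitPlane {c : ℂ} (hc : c ∈ slitPlane) {u : ℝ} (hu : 0 < u) :
    (u : ℂ) * c ∈ slitPlane := by
  rw [mem_slitPlane_iff] at hc ⊢
  simp only [re_ofReal_mul, im_ofReal_mul]
  rcases hc with h | h
  · left; positivity
  · right; exact mul_ne_zero hu.ne' h

lemma ofReal_mul_cpow_of_pos {a : ℝ} (ha : 0 < a) {c : ℂ} (hc : c ≠ 0) (b : ℝ) :
    ((a : ℂ) * c) ^ (b : ℂ) = ((a ^ b : ℝ) : ℂ) * c ^ (b : ℂ) := by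
  have ha' : (a : ℂ) ≠ 0 := by exact_mod_cast ha.ne'
  rw [ofReal_cpow ha.le, cpow_def_of_ne_zero (mul_ne_zero ha' hc), cpow_def_of_ne_zero ha',
    cpow_def_of_ne_zero hc, log_ofReal_mul ha hc, ← exp_add, ← ofReal_log ha.le]
  ring_nf

/-- Pulling out (c/u)^{-b} from (1 + c/u)^{-b} leaves (1 + u/c)^{-b}: inversion exchanges s with b -
s and c with c⁻¹. -/
lemma mellinKernel_inv {b s : ℝ} {c : ℂ} (hc : c ∈ slitPlane) {u : ℝ} (hu : 0 < u) :
    |(-(u ^ 2)⁻¹)| • mellinKernel b s c u⁻¹ = c ^ (-b : ℂ) * mellinKernel b (b - s) c⁻¹ u := by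
  have h1 : c * ((u⁻¹ : ℝ) : ℂ) = ((u⁻¹ : ℝ) : ℂ) * c := mul_comm _ _
  have huc : (u : ℂ) ≠ 0 := by exact_mod_cast hu.ne'
  rw [mellinKernel, mellinKernel, h1, one_add_inv_cpow (ofReal_mul_mem_slitPlane hc (by positivity)),
    abs_neg, abs_of_pos (by positivity), real_smul, mul_inv, ← ofReal_inv, inv_inv,
    show (-b : ℂ) = ((-b : ℝ) : ℂ) by push_cast; rfl, ofReal_mul_cpow_of_pos (by positivity) (slitPlane_ne_zero hc),
    mul_comm (u : ℂ) c⁻¹]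
  have : ((u : ℝ) ^ 2)⁻¹ * ((u⁻¹) ^ (s - 1) * (u⁻¹) ^ (-b)) = u ^ (b - s - 1) := by
    rw [Real.inv_rpow hu.le, Real.inv_rpow hu.le, ← Real.rpow_neg hu.le, ← Real.rpow_neg hu.le,
      ← Real.rpow_natCast, ← Real.rpow_neg hu.le, ← Real.rpow_add hu, ← Real.rpow_add hu]
    congr 1; push_cast; ring
  rw [← this]
  push_cast
  ring

lemma image_inv_Ioo : (fun u : ℝ => u⁻¹) '' Ioo 0 1 = Ioi 1 := by
  ext v
  simp only [mem_image, mem_Ioo, mem_Ioi]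
  constructor
  · rintro ⟨u, ⟨h0, h1⟩, rfl⟩
    exact (one_lt_inv₀ h0).2 h1
  · intro h
    exact ⟨v⁻¹, ⟨by positivity, inv_lt_one_of_one_lt₀ h⟩, inv_inv v⟩

lemma integral_mellinKernel_Ioi_one {b s : ℝ} {c : ℂ} (hc : c ∈ slitPlane) :
    ∫ v in Ioi (1 : ℝ), mellinKernel b s c v =
      c ^ (-b : ℂ) * ∫ u in Ioo (0 : ℝ) 1, mellinKernel b (b - s) c⁻¹ u := by
  rw [← image_inv_Ioo, integral_image_eq_integral_abs_deriv_smul measurableSet_Ioo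
    (fun u hu => (hasDerivAt_inv (ne_of_gt hu.1)).hasDerivWithinAt) inv_injective.injOn,
    ← integral_const_mul]
  exact setIntegral_congr_fun measurableSet_Ioo fun u hu => mellinKernel_inv hc hu.1

/-- The Mellin transform of `(1 + c v) ^ (-b)`, folded to the unit interval. -/
lemma integral_mellinKernel_Ioo {b s : ℝ} (hs : 0 < s) (hb : s < b) {c : ℂ}
    (hc : c ∈ slitPlane) :
    (∫ u in Ioo (0 : ℝ) 1, mellinKernel b s c u) +
      c ^ (-b : ℂ) * ∫ u in Ioo (0 : ℝ) 1, mellinKernel b (b - s) c⁻¹ u =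
      c ^ (-s : ℂ) * betaIntegral s ((b - s : ℝ) : ℂ) := by
  rw [← integral_mellinKernel hs hb hc, ← integral_mellinKernel_Ioi_one hc,
    ← integral_Ioc_eq_integral_Ioo, ← setIntegral_union (by simp) measurableSet_Ioi,
    Ioc_union_Ioi_eq_Ioi zero_le_one]
  · exact (integrableOn_mellinKernel hs hb hc).mono_set Ioc_subset_Ioi_self
  · exact (integrableOn_mellinKernel hs hb hc).mono_set (Ioi_subset_Ioi zero_le_one)

end AperySeries
end

/-! ### Central binomial coefficients and series expansions of the folded integrals. -/

noncomputable section
namespace AperySeries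
open Complex MeasureTheory Set

/-- The normalized central binomial coefficient `binom(2n, n) / 4 ^ n`. -/
def centralCoeff (n : ℕ) : ℝ := ((2 * n).choose n : ℝ) / 4 ^ n

lemma centralCoeff_zero : centralCoeff 0 = 1 := by simp [centralCoeff]

lemma centralCoeff_succ (n : ℕ) :
    centralCoeff (n + 1) * (2 * n + 2) = centralCoeff n * (2 * n + 1) := by
  have h := Nat.succ_mul_centralBinom_succ n
  rw [Nat.centralBinom_eq_two_mul_choose, Nat.centralBinom_eq_two_mul_choose] at h
  have h' : ((n : ℝ) + 1) * ((2 * (n + 1)).choose (n + 1) : ℝ) =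
      2 * (2 * n + 1) * ((2 * n).choose n : ℝ) := by exact_mod_cast h
  rw [centralCoeff, centralCoeff, pow_succ, div_mul_eq_mul_div, div_mul_eq_mul_div,
    div_eq_div_iff (by positivity) (by positivity)]
  linear_combination (2 * 4 ^ n) * h'

lemma centralCoeff_pos (n : ℕ) : 0 < centralCoeff n := by
  have := Nat.centralBinom_pos n
  rw [Nat.centralBinom_eq_two_mul_choose] at this
  unfold centralCoeff
  positivity

/-- The left side decreases in n because (2n+1)(2n+3) ≤ (2n+2)². It yields the decay n^{-1/2},
enough for absolute convergence after one division by n. -/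
lemma centralCoeff_sq_le (n : ℕ) : centralCoeff n ^ 2 * (2 * n + 1) ≤ 1 := by
  induction n with
  | zero => simp [centralCoeff_zero]
  | succ n ih =>
    have h := centralCoeff_succ n
    have h2 : centralCoeff (n + 1) = centralCoeff n * ((2 * n + 1) / (2 * n + 2)) := by
      field_simp; linarith
    refine le_trans ?_ ih
    rw [h2, mul_pow, mul_assoc]
    gcongr
    rw [div_pow, div_mul_eq_mul_div, div_le_iff₀ (by positivity)]
    push_cast
    nlinarith [(Nat.cast_nonneg n : (0 : ℝ) ≤ n)]

lemma centralCoeff_le (n : ℕ) : centralCoeff n ≤ ((n : ℝ) + 1) ^ (-(1 / 2) : ℝ) := by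
  have h0 : (0 : ℝ) < (n : ℝ) + 1 := by positivity
  refine le_of_sq_le_sq ?_ (by positivity)
  rw [← Real.rpow_natCast (((n : ℝ) + 1) ^ _), ← Real.rpow_mul h0.le]
  norm_num
  rw [Real.rpow_neg_one, ← one_div, le_div_iff₀ h0]
  refine le_trans ?_ (centralCoeff_sq_le n)
  gcongr
  linarith [(Nat.cast_nonneg n : (0 : ℝ) ≤ n)]

lemma centralCoeff_antitone : Antitone centralCoeff := by
  refine antitone_nat_of_succ_le fun n => ?_
  have h := centralCoeff_succ n
  have := centralCoeff_pos (n + 1)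
  have := centralCoeff_pos n
  nlinarith [(Nat.cast_nonneg n : (0 : ℝ) ≤ n)]

lemma tendsto_centralCoeff : Tendsto centralCoeff atTop (𝓝 0) := by
  refine squeeze_zero (fun n => (centralCoeff_pos n).le) centralCoeff_le ?_
  refine (tendsto_rpow_neg_atTop (by norm_num : (0 : ℝ) < 1 / 2)).comp ?_
  exact tendsto_atTop_add_const_right _ _ tendsto_natCast_atTop_atTop

lemma summable_centralCoeff_div : Summable fun n : ℕ => centralCoeff n / ((n : ℝ) + 1) := by
  have h : Summable fun n : ℕ => ((n : ℝ) + 1) ^ (-(3 / 2) : ℝ) := by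
    have := (summable_nat_add_iff 1).2 (Real.summable_nat_rpow.2 (by norm_num : (-(3 / 2) : ℝ) < -1))
    simpa using this
  refine h.of_nonneg_of_le (fun n => ?_) (fun n => ?_)
  · have := centralCoeff_pos n; positivity
  · have h0 : (0 : ℝ) < (n : ℝ) + 1 := by positivity
    rw [div_le_iff₀ h0]
    refine (centralCoeff_le n).trans (le_of_eq ?_)
    nth_rw 3 [← Real.rpow_one ((n : ℝ) + 1)]
    rw [← Real.rpow_add h0]; norm_num

lemma summable_centralCoeff_div_add {s : ℝ} (hs : 0 < s) :
    Summable fun n : ℕ => centralCoeff n / ((n : ℝ) + s) := by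
  refine (summable_centralCoeff_div.mul_left (1 + s⁻¹)).of_nonneg_of_le (fun n => ?_) (fun n => ?_)
  · have := centralCoeff_pos n; positivity
  · have h := centralCoeff_pos n
    have hn : (0 : ℝ) ≤ n := Nat.cast_nonneg n
    rw [div_le_iff₀ (by positivity)]
    have : (1 + s⁻¹) * (centralCoeff n / ((n : ℝ) + 1)) * (n + s) =
        centralCoeff n * ((1 + s⁻¹) * (n + s) / (n + 1)) := by ring
    rw [this]
    refine le_mul_of_one_le_right h.le ?_
    rw [one_le_div (by positivity)]
    have e : (1 + s⁻¹) * ((n : ℝ) + s) = n + 1 + s + n * s⁻¹ := by field_simp; ring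
    rw [e]
    have : (0 : ℝ) ≤ n * s⁻¹ := by positivity
    linarith

lemma ring_choose_neg_half (n : ℕ) :
    Ring.choose (-(1 / 2) : ℂ) n = (-1) ^ n * (centralCoeff n : ℂ) := by
  have key : (descPochhammer ℤ n).smeval (-(1 / 2) : ℂ) =
      (n.factorial : ℂ) * ((-1) ^ n * (centralCoeff n : ℂ)) := by
    induction n with
    | zero => simp [centralCoeff_zero]
    | succ n ih =>
      have h : (centralCoeff (n + 1) : ℂ) * (2 * n + 2) = centralCoeff n * (2 * n + 1) := by
        exact_mod_cast congrArg (fun r : ℝ => (r : ℂ)) (centralCoeff_succ n)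
      rw [descPochhammer_succ_right, Polynomial.smeval_mul, ih]
      simp only [Polynomial.smeval_sub, Polynomial.smeval_X, Polynomial.smeval_natCast, pow_one,
        pow_zero, nsmul_eq_mul, mul_one, Nat.factorial_succ, Nat.cast_mul, Nat.cast_add,
        Nat.cast_one]
      linear_combination (-(1 / 2) * (n.factorial : ℂ) * (-1) ^ (n + 1)) * h
  rw [Ring.descPochhammer_eq_factorial_smul_choose, nsmul_eq_mul] at key
  exact mul_left_cancel₀ (by exact_mod_cast n.factorial_ne_zero) key

lemma hasSum_centralCoeff {z : ℂ} (hz : ‖z‖ < 1) :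
    HasSum (fun n : ℕ => (centralCoeff n : ℂ) * z ^ n) ((1 - z) ^ (-(1 / 2) : ℂ)) := by
  have h := (one_add_cpow_hasFPowerSeriesOnBall_zero (a := (-(1 / 2) : ℂ))).hasSum (y := -z)
    (by simpa [enorm_eq_nnnorm, ← NNReal.coe_lt_coe] using hz)
  rw [zero_add, ← sub_eq_add_neg] at h
  convert! h using 2 with n
  rw [binomialSeries_apply, ring_choose_neg_half]
  simp only [List.ofFn_const, List.prod_replicate, smul_eq_mul]
  rw [neg_pow z, mul_comm ((-1 : ℂ) ^ n) (centralCoeff n : ℂ), mul_assoc, ← mul_assoc ((-1 : ℂ) ^ n),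
    ← mul_pow]
  simp

lemma integrableOn_rpow_Ioo {s : ℝ} (hs : 0 < s) :
    IntegrableOn (fun u : ℝ => u ^ (s - 1)) (Ioo 0 1) :=
  (intervalIntegral.integrableOn_Ioo_rpow_iff zero_lt_one).2 (by linarith)

lemma integral_rpow_Ioo {s : ℝ} (hs : 0 < s) : ∫ u in Ioo (0 : ℝ) 1, u ^ (s - 1) = 1 / s := by
  rw [← integral_Ioc_eq_integral_Ioo, ← intervalIntegral.integral_of_le zero_le_one,
    integral_rpow (Or.inl (by linarith))]
  simp [Real.zero_rpow hs.ne']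

lemma integral_pow_mul_rpow_Ioo {s : ℝ} (hs : 0 < s) (z : ℂ) (n : ℕ) :
    ∫ u in Ioo (0 : ℝ) 1, ((u ^ (s - 1) : ℝ) : ℂ) * (z * u) ^ n = z ^ n / (n + s) := by
  have hns : (0 : ℝ) < n + s := by positivity
  have h : ∀ u ∈ Ioo (0 : ℝ) 1, ((u ^ (s - 1) : ℝ) : ℂ) * (z * u) ^ n =
      z ^ n * ((u ^ (n + s - 1) : ℝ) : ℂ) := by
    intro u hu
    rw [show (n + s - 1 : ℝ) = (s - 1) + n by ring, Real.rpow_add_natCast hu.1.ne']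
    push_cast; ring
  rw [setIntegral_congr_fun measurableSet_Ioo h, integral_const_mul, integral_complex_ofReal,
    integral_rpow_Ioo hns]
  push_cast; ring

lemma integrableOn_pow_mul_rpow {s : ℝ} (hs : 0 < s) (z : ℂ) (n : ℕ) :
    IntegrableOn (fun u : ℝ => ((u ^ (s - 1) : ℝ) : ℂ) * (z * u) ^ n) (Ioo 0 1) := by
  have hns : (0 : ℝ) < n + s := by positivity
  refine IntegrableOn.congr_fun ((integrableOn_rpow_Ioo hns).ofReal.const_mul (z ^ n))
    (fun u hu => ?_) measurableSet_Ioo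
  show z ^ n * ((u ^ (n + s - 1) : ℝ) : ℂ) = _
  rw [show (n + s - 1 : ℝ) = (s - 1) + n by ring, Real.rpow_add_natCast hu.1.ne', mul_pow]
  push_cast
  ring

/-- Termwise integration of the binomial series is legitimate on the whole circle, z = 1 included,
because the integrals of the norms sum to ∑ c_n / (n + s), which is finite. -/
lemma hasSum_integral_mellinKernel_half {s : ℝ} (hs : 0 < s) {z : ℂ} (hz : ‖z‖ = 1) :
    HasSum (fun n : ℕ => (centralCoeff n : ℂ) * z ^ n / (n + s))
      (∫ u in Ioo (0 : ℝ) 1, mellinKernel (1 / 2) s (-z) u) := by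
  have h := hasSum_integral_of_summable_integral_norm (μ := volume.restrict (Ioo (0 : ℝ) 1))
    (F := fun (n : ℕ) u => (centralCoeff n : ℂ) * (((u ^ (s - 1) : ℝ) : ℂ) * (z * u) ^ n))
    (fun n => (integrableOn_pow_mul_rpow hs z n).const_mul _) ?_
  · convert! h using 1
    · ext n
      rw [integral_const_mul, integral_pow_mul_rpow_Ioo hs, mul_div_assoc]
    · refine setIntegral_congr_fun measurableSet_Ioo fun u hu => ?_
      have h1 : ‖z * u‖ < 1 := by
        rw [norm_mul, hz, one_mul, norm_real, Real.norm_of_nonneg hu.1.le]; exact hu.2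
      have h2 := ((hasSum_centralCoeff h1).mul_left ((u ^ (s - 1) : ℝ) : ℂ)).tsum_eq
      simp only [mellinKernel]
      rw [neg_mul, ← sub_eq_add_neg, show (-((1 / 2 : ℝ) : ℂ)) = -(1 / 2) by push_cast; rfl, ← h2]
      exact tsum_congr fun n => by ring
  · refine (summable_centralCoeff_div_add hs).congr fun n => ?_
    have hns : (0 : ℝ) < n + s := by positivity
    have h : ∀ u ∈ Ioo (0 : ℝ) 1,
        ‖(centralCoeff n : ℂ) * (((u ^ (s - 1) : ℝ) : ℂ) * (z * u) ^ n)‖ =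
        centralCoeff n * u ^ (n + s - 1) := by
      intro u hu
      rw [show (n + s - 1 : ℝ) = (s - 1) + n by ring, Real.rpow_add_natCast hu.1.ne', norm_mul,
        norm_mul, norm_pow, norm_mul, hz, one_mul, norm_real, norm_real, norm_real,
        Real.norm_of_nonneg hu.1.le, Real.norm_of_nonneg (centralCoeff_pos n).le,
        Real.norm_of_nonneg (Real.rpow_nonneg hu.1.le _)]
    rw [setIntegral_congr_fun measurableSet_Ioo h, integral_const_mul, integral_rpow_Ioo hns]
    ring

lemma neg_mem_slitPlane {z : ℂ} (hz : ‖z‖ = 1) (hz1 : z ≠ 1) : -z ∈ slitPlane := by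
  rw [mem_slitPlane_iff]
  by_contra! h
  apply hz1
  simp only [neg_re, neg_im, neg_eq_zero, Left.neg_nonpos_iff] at h
  have h2 : z = (z.re : ℂ) := by apply Complex.ext <;> simp [h.2]
  rw [h2, norm_real, Real.norm_of_nonneg h.1] at hz
  rw [h2, hz, ofReal_one]

/-- For b = 1 the series is not absolutely convergent, so the geometric sum is kept finite: its
remainder is (z u)^N / (1 - z u), and |1 - z u| ≥ δ makes the error at most δ⁻¹ / (N + s). -/
lemma tendsto_sum_integral_mellinKernel_one {s : ℝ} (hs : 0 < s) {z : ℂ} (hz : ‖z‖ = 1)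
    (hz1 : z ≠ 1) :
    Tendsto (fun N : ℕ => ∑ n ∈ Finset.range N, z ^ n / (n + s)) atTop
      (𝓝 (∫ u in Ioo (0 : ℝ) 1, mellinKernel 1 s (-z) u)) := by
  have hsl := neg_mem_slitPlane hz hz1
  obtain ⟨δ, hδ, hδ'⟩ := exists_norm_one_add_mul_ge hsl
  have hlow := (hδ' _ (Metric.mem_ball_self hδ)).2
  have hint : IntegrableOn (mellinKernel 1 s (-z)) (Ioo 0 1) := by
    refine Integrable.mono' ((integrableOn_rpow_Ioo hs).const_mul δ⁻¹)
      (((continuousOn_mellinKernel hsl).mono Ioo_subset_Ioi_self).aestronglyMeasurable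
        measurableSet_Ioo) ?_
    filter_upwards [ae_restrict_mem measurableSet_Ioo] with u hu
    refine (norm_mellinKernel_le hδ hu.1 zero_le_one (hlow u hu.1.le)).trans ?_
    rw [Real.rpow_neg_one, Real.rpow_neg_one]
    have h1 : (1 + u)⁻¹ ≤ 1 := inv_le_one_of_one_le₀ (by linarith [hu.1])
    have h2 : 0 ≤ u ^ (s - 1) := Real.rpow_nonneg hu.1.le _
    gcongr
    exact mul_le_of_le_one_right h2 h1
  rw [tendsto_iff_norm_sub_tendsto_zero]
  have hlim : Tendsto (fun N : ℕ => δ⁻¹ * (1 / ((N : ℝ) + s))) atTop (𝓝 0) := by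
    have : Tendsto (fun N : ℕ => (N : ℝ) + s) atTop atTop :=
      tendsto_atTop_add_const_right _ _ tendsto_natCast_atTop_atTop
    simpa using (this.inv_tendsto_atTop).const_mul δ⁻¹
  refine squeeze_zero (fun _ => norm_nonneg _) (fun N => ?_) hlim
  have hNs : (0 : ℝ) < N + s := by positivity
  have h1 : ∑ n ∈ Finset.range N, z ^ n / ((n : ℂ) + s) = ∫ u in Ioo (0 : ℝ) 1,
      ∑ n ∈ Finset.range N, ((u ^ (s - 1) : ℝ) : ℂ) * (z * u) ^ n := by
    rw [integral_finsetSum _ fun n _ => integrableOn_pow_mul_rpow hs z n]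
    exact Finset.sum_congr rfl fun n _ => (integral_pow_mul_rpow_Ioo hs z n).symm
  rw [h1, ← integral_sub (integrable_finsetSum _ fun n _ => integrableOn_pow_mul_rpow hs z n) hint,
    ← integral_rpow_Ioo hNs, ← integral_const_mul]
  refine norm_integral_le_of_norm_le ((integrableOn_rpow_Ioo hNs).const_mul _) ?_
  filter_upwards [ae_restrict_mem measurableSet_Ioo] with u hu
  have hne : 1 - z * u ≠ 0 := by
    have := slitPlane_ne_zero (one_add_mul_mem_slitPlane hsl hu.1.le)
    rwa [neg_mul, ← sub_eq_add_neg] at this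
  have hge : δ ≤ ‖1 - z * u‖ := by
    have := hlow u hu.1.le
    rw [neg_mul, ← sub_eq_add_neg] at this
    nlinarith [hu.1]
  have h2 : ∑ n ∈ Finset.range N, ((u ^ (s - 1) : ℝ) : ℂ) * (z * u) ^ n -
      mellinKernel 1 s (-z) u = -(((u ^ (s - 1) : ℝ) : ℂ) * (z * u) ^ N * (1 - z * u)⁻¹) := by
    rw [← Finset.mul_sum, mellinKernel, ofReal_one, cpow_neg_one, neg_mul, ← sub_eq_add_neg]
    have h3 := mul_neg_geom_sum (z * u) N
    have h4 : ∑ n ∈ Finset.range N, (z * u) ^ n = (1 - (z * u) ^ N) * (1 - z * u)⁻¹ := by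
      rw [← h3]; field_simp
    rw [h4]; ring
  rw [h2, norm_neg, norm_mul, norm_mul, norm_pow, norm_mul, hz, one_mul, norm_real, norm_real,
    Real.norm_of_nonneg hu.1.le, Real.norm_of_nonneg (Real.rpow_nonneg hu.1.le _), norm_inv,
    show (N + s - 1 : ℝ) = (s - 1) + N by ring, Real.rpow_add_natCast hu.1.ne', mul_comm]
  have : ‖1 - z * u‖⁻¹ ≤ δ⁻¹ := inv_anti₀ hδ hge
  have h5 : 0 ≤ u ^ (s - 1) := Real.rpow_nonneg hu.1.le _
  have h6 : 0 ≤ u ^ N := pow_nonneg hu.1.le _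
  gcongr

/-- Dirichlet's test gives convergence (decreasing coefficients, bounded geometric sums); Abel's
limit theorem then identifies the sum with the boundary value of the binomial function. -/
lemma tendsto_sum_centralCoeff {z : ℂ} (hz : ‖z‖ = 1) (hz1 : z ≠ 1) :
    Tendsto (fun N : ℕ => ∑ n ∈ Finset.range N, (centralCoeff n : ℂ) * z ^ n) atTop
      (𝓝 ((1 - z) ^ (-(1 / 2) : ℂ))) := by
  have hb : ∀ n, ‖∑ i ∈ Finset.range n, z ^ i‖ ≤ 2 / ‖1 - z‖ := by
    intro n
    have h3 := mul_neg_geom_sum z n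
    have hne : 0 < ‖1 - z‖ := norm_pos_iff.2 (sub_ne_zero.2 hz1.symm)
    rw [le_div_iff₀ hne, mul_comm, ← norm_mul, h3]
    refine (norm_sub_le _ _).trans ?_
    rw [norm_pow, hz]; norm_num
  have hc := centralCoeff_antitone.cauchySeq_series_mul_of_tendsto_zero_of_bounded
    tendsto_centralCoeff hb
  obtain ⟨l, hl⟩ := cauchySeq_tendsto_of_complete hc
  simp only [real_smul] at hl
  have habel := Complex.tendsto_tsum_powerSeries_nhdsWithin_lt hl
  rw [tendsto_map'_iff] at habel
  have hsl : 1 - z ∈ slitPlane := by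
    have := one_add_mul_mem_slitPlane (neg_mem_slitPlane hz hz1) zero_le_one
    simpa [sub_eq_add_neg] using this
  have h2 : Tendsto (fun r : ℝ => (1 - z * r) ^ (-(1 / 2) : ℂ)) (𝓝[<] 1)
      (𝓝 ((1 - z) ^ (-(1 / 2) : ℂ))) := by
    have : ContinuousAt (fun r : ℝ => (1 - z * r) ^ (-(1 / 2) : ℂ)) 1 :=
      ContinuousAt.cpow (by fun_prop) continuousAt_const (by simpa using hsl)
    have h := this.tendsto
    simp only [ofReal_one, mul_one] at h
    exact h.mono_left nhdsWithin_le_nhds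
  have h3 := tendsto_nhds_unique_of_eventuallyEq habel h2 ?_
  · rwa [h3] at hl
  · filter_upwards [Ioo_mem_nhdsLT (show (0 : ℝ) < 1 by norm_num)] with r hr
    have h1 : ‖z * r‖ < 1 := by
      rw [norm_mul, hz, one_mul, norm_real, Real.norm_of_nonneg hr.1.le]; exact hr.2
    rw [← (hasSum_centralCoeff h1).tsum_eq]
    exact tsum_congr fun n => by simp only [mul_pow]; ring

end AperySeries
end

/-! ### Calculus of Taylor series at 0. -/

noncomputable section
namespace AperySeries

/-- `f` is the sum of the power series `P` near `0`. -/
def HasTaylor (f : ℂ → ℂ) (P : PowerSeries ℂ) : Prop :=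
  ∀ᶠ t in 𝓝 (0 : ℂ), HasSum (fun n : ℕ => PowerSeries.coeff n P * t ^ n) (f t)

namespace HasTaylor

variable {f g : ℂ → ℂ} {P Q : PowerSeries ℂ}

lemma iff_hasFPowerSeriesAt : HasTaylor f P ↔ HasFPowerSeriesAt f
    (FormalMultilinearSeries.ofScalars ℂ fun n => PowerSeries.coeff n P) 0 := by
  rw [hasFPowerSeriesAt_iff, HasTaylor]
  simp only [zero_add, FormalMultilinearSeries.coeff_ofScalars, smul_eq_mul, mul_comm]

lemma analyticAt (h : HasTaylor f P) : AnalyticAt ℂ f 0 :=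
  (iff_hasFPowerSeriesAt.1 h).analyticAt

lemma unique (hP : HasTaylor f P) (hQ : HasTaylor f Q) : P = Q := by
  have h := (iff_hasFPowerSeriesAt.1 hP).eq_formalMultilinearSeries (iff_hasFPowerSeriesAt.1 hQ)
  rw [FormalMultilinearSeries.ofScalars_series_eq_iff] at h
  exact PowerSeries.ext fun n => congrFun h n

lemma congr (hP : HasTaylor f P) (h : f =ᶠ[𝓝 0] g) : HasTaylor g P := by
  filter_upwards [hP, h] with t h1 h2
  rwa [← h2]

lemma of_analyticAt (h : AnalyticAt ℂ f 0) :
    HasTaylor f (PowerSeries.mk fun n => iteratedDeriv n f 0 / n.factorial) := by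
  rw [iff_hasFPowerSeriesAt]
  simpa using h.hasFPowerSeriesAt

lemma coeff_eq (h : HasTaylor f P) (n : ℕ) :
    PowerSeries.coeff n P = iteratedDeriv n f 0 / n.factorial := by
  rw [h.unique (of_analyticAt h.analyticAt), PowerSeries.coeff_mk]

lemma deriv (h : HasTaylor f P) : HasTaylor (deriv f) (PowerSeries.derivative ℂ P) := by
  have := of_analyticAt h.analyticAt.deriv
  convert! this using 1
  ext n
  rw [PowerSeries.coeff_derivative, h.coeff_eq, PowerSeries.coeff_mk, iteratedDeriv_succ',
    Nat.factorial_succ]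
  have : ((n : ℂ) + 1) ≠ 0 := by exact_mod_cast n.succ_ne_zero
  have : (n.factorial : ℂ) ≠ 0 := by exact_mod_cast n.factorial_ne_zero
  push_cast
  field_simp

lemma add (hf : HasTaylor f P) (hg : HasTaylor g Q) : HasTaylor (fun t => f t + g t) (P + Q) := by
  filter_upwards [hf, hg] with t h1 h2
  simpa only [map_add, add_mul] using h1.add h2

lemma mul (hf : HasTaylor f P) (hg : HasTaylor g Q) : HasTaylor (fun t => f t * g t) (P * Q) := by
  filter_upwards [hf, hg] with t h1 h2
  have hs := summable_norm_sum_mul_antidiagonal_of_summable_norm h1.summable.norm h2.summable.norm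
  have ht := tsum_mul_tsum_eq_tsum_sum_antidiagonal_of_summable_norm h1.summable.norm
    h2.summable.norm
  rw [h1.tsum_eq, h2.tsum_eq] at ht
  rw [ht]
  convert! hs.of_norm.hasSum using 2 with n
  rw [PowerSeries.coeff_mul, Finset.sum_mul]
  refine Finset.sum_congr rfl fun p hp => ?_
  rw [← Finset.HasAntidiagonal.mem_antidiagonal.1 hp, pow_add]
  ring

lemma const (c : ℂ) : HasTaylor (fun _ => c) (PowerSeries.C c) := by
  refine Eventually.of_forall fun t => ?_
  convert! hasSum_single (f := fun n : ℕ => PowerSeries.coeff n (PowerSeries.C c) * t ^ n) 0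
    fun n hn => ?_ using 1
  · simp
  · simp [PowerSeries.coeff_C, hn]

lemma id : HasTaylor (fun t => t) PowerSeries.X := by
  refine Eventually.of_forall fun t => ?_
  convert! hasSum_single (f := fun n : ℕ => PowerSeries.coeff n (PowerSeries.X : PowerSeries ℂ) * t ^ n) 1
    fun n hn => ?_ using 1
  · simp
  · simp [PowerSeries.coeff_X, hn]

lemma comp_mul (h : HasTaylor f P) (c : ℂ) :
    HasTaylor (fun t => f (c * t)) (PowerSeries.rescale c P) := by
  have : Tendsto (fun t : ℂ => c * t) (𝓝 0) (𝓝 0) := by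
    have : Continuous fun t : ℂ => c * t := by fun_prop
    simpa using this.tendsto 0
  filter_upwards [this.eventually h] with t ht
  convert! ht using 2 with n
  rw [PowerSeries.coeff_rescale, mul_pow]; ring

lemma neg (h : HasTaylor f P) : HasTaylor (fun t => -f t) (-P) := by
  filter_upwards [h] with t ht
  simpa using ht.neg

lemma apply_zero (h : HasTaylor f P) : f 0 = PowerSeries.coeff 0 P := by
  have := h.coeff_eq 0
  simpa using this.symm

lemma eq_of_derivative_eq_mul {P Q G : PowerSeries ℂ} (hP : PowerSeries.derivative ℂ P = G * P)
    (hQ : PowerSeries.derivative ℂ Q = G * Q)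
    (h0 : PowerSeries.coeff 0 P = PowerSeries.coeff 0 Q) : P = Q := by
  ext n
  induction n using Nat.strong_induction_on with
  | _ n ih =>
    cases n with
    | zero => exact h0
    | succ n =>
      have h1 := congrArg (PowerSeries.coeff n) hP
      have h2 := congrArg (PowerSeries.coeff n) hQ
      rw [PowerSeries.coeff_derivative, PowerSeries.coeff_mul] at h1 h2
      have hn : ((n : ℂ) + 1) ≠ 0 := by exact_mod_cast n.succ_ne_zero
      apply mul_right_cancel₀ hn
      rw [h1, h2]
      refine Finset.sum_congr rfl fun p hp => ?_
      rw [ih p.2 (by have := Finset.HasAntidiagonal.mem_antidiagonal.1 hp; omega)]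

/-- The analytic exponential and the formal substitution both solve E' = P' E with constant term 1,
and this equation determines the coefficients recursively. -/
lemma exp (h : HasTaylor f P) (h0 : PowerSeries.constantCoeff P = 0) :
    HasTaylor (fun t => Complex.exp (f t)) ((PowerSeries.exp ℂ).subst P) := by
  have hs : PowerSeries.HasSubst P := PowerSeries.HasSubst.of_constantCoeff_zero' h0
  have hE := of_analyticAt (f := fun t => Complex.exp (f t)) h.analyticAt.cexp
  set E := PowerSeries.mk fun n => iteratedDeriv n (fun t => Complex.exp (f t)) 0 / (n.factorial : ℂ)
  have hd : HasTaylor (_root_.deriv fun t => Complex.exp (f t)) (PowerSeries.derivative ℂ P * E) := by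
    refine (h.deriv.mul hE).congr ?_
    filter_upwards [h.analyticAt.eventually_analyticAt] with t ht
    rw [ht.differentiableAt.hasDerivAt.cexp.deriv, mul_comm]
  have h1 : PowerSeries.derivative ℂ E = PowerSeries.derivative ℂ P * E := hE.deriv.unique hd
  have h2 : PowerSeries.derivative ℂ ((PowerSeries.exp ℂ).subst P) =
      PowerSeries.derivative ℂ P * (PowerSeries.exp ℂ).subst P := by
    rw [PowerSeries.derivative_subst hs, PowerSeries.derivative_exp, mul_comm]
  have h3 : PowerSeries.coeff 0 ((PowerSeries.exp ℂ).subst P) = 1 := by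
    have := PowerSeries.constantCoeff_subst hs (PowerSeries.exp ℂ)
    rw [PowerSeries.coeff_zero_eq_constantCoeff_apply]
    refine Eq.trans this ?_
    rw [finsum_eq_single _ 0]
    · simp
    · intro n hn
      have hc : MvPowerSeries.constantCoeff P = 0 := h0
      rw [map_pow, hc, zero_pow hn, smul_zero]
  have h4 : E = (PowerSeries.exp ℂ).subst P := by
    refine eq_of_derivative_eq_mul h1 h2 ?_
    rw [h3, ← hE.apply_zero, h.apply_zero, PowerSeries.coeff_zero_eq_constantCoeff_apply, h0,
      Complex.exp_zero]
  rwa [← h4]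

/-- The integral identities are available only for small real t > 0; such points accumulate at 0,
which suffices to equate all coefficients. -/
lemma eq_of_eqOn_Ioo (hf : HasTaylor f P) (hg : HasTaylor g Q) {ρ : ℝ} (hρ : 0 < ρ)
    (h : ∀ t : ℝ, 0 < t → t < ρ → f t = g t) : P = Q := by
  have hfreq : ∃ᶠ z in 𝓝[≠] (0 : ℂ), f z = g z := by
    have hu : Tendsto (fun t : ℝ => (t : ℂ)) (𝓝[>] 0) (𝓝[≠] 0) := by
      refine tendsto_nhdsWithin_iff.2 ⟨?_, ?_⟩
      · have := Complex.continuous_ofReal.tendsto 0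
        rw [Complex.ofReal_zero] at this
        exact this.mono_left nhdsWithin_le_nhds
      · filter_upwards [self_mem_nhdsWithin] with t ht
        simpa using (ne_of_gt ht : t ≠ 0)
    refine hu.frequently (Eventually.frequently ?_)
    filter_upwards [Ioo_mem_nhdsGT hρ] with t ht
    exact h t ht.1 ht.2
  exact (hf.congr ((hf.analyticAt.frequently_eq_iff_eventually_eq hg.analyticAt).1 hfreq)).unique hg

/-- Each w / (b - t) is a geometric series in t / b. The double series is dominated by (‖w‖ / ‖b‖)
(‖t‖ / ρ)^r, so the summations may be exchanged. -/
lemma tsum_div_sub {w b : ℕ → ℂ} {ρ : ℝ} (hρ : 0 < ρ) (hb : ∀ n, ρ ≤ ‖b n‖)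
    (hw : Summable fun n => ‖w n‖ / ‖b n‖) :
    HasTaylor (fun t => ∑' n, w n / (b n - t)) (PowerSeries.mk fun r => ∑' n, w n / b n ^ (r + 1)) := by
  filter_upwards [Metric.ball_mem_nhds (0 : ℂ) hρ] with t ht
  rw [mem_ball_zero_iff] at ht
  have hs : Summable fun p : ℕ × ℕ => w p.1 / b p.1 ^ (p.2 + 1) * t ^ p.2 := by
    have hg : Summable fun r : ℕ => (‖t‖ / ρ) ^ r :=
      summable_geometric_of_lt_one (by positivity) ((div_lt_one hρ).2 ht)
    refine Summable.of_norm_bounded (hw.mul_of_nonneg hg (fun n => by positivity)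
      (fun n => by positivity)) fun p => ?_
    have hbp : 0 < ‖b p.1‖ := hρ.trans_le (hb p.1)
    rw [norm_mul, norm_div, norm_pow, norm_pow, pow_succ']
    calc _ = ‖w p.1‖ / ‖b p.1‖ * (‖t‖ / ‖b p.1‖) ^ p.2 := by rw [div_pow]; field_simp
      _ ≤ _ := by gcongr; exact hb p.1
  have h1 : HasSum (fun p : ℕ × ℕ => w p.1 / b p.1 ^ (p.2 + 1) * t ^ p.2)
      (∑' n, w n / (b n - t)) := by
    convert! hs.hasSum using 1
    rw [hs.tsum_prod]
    refine tsum_congr fun n => ?_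
    have hbp : 0 < ‖b n‖ := hρ.trans_le (hb n)
    have hbn : b n ≠ 0 := norm_pos_iff.1 hbp
    have hlt : ‖t / b n‖ < 1 := by
      rw [norm_div, div_lt_one hbp]; exact ht.trans_le (hb n)
    have hne : b n - t ≠ 0 := by
      intro h
      rw [sub_eq_zero] at h
      rw [← h] at ht
      exact absurd ht (not_lt.2 (hb n))
    have h2 := ((hasSum_geometric_of_norm_lt_one hlt).mul_left (w n / b n)).tsum_eq
    have h3 : w n / b n * (1 - t / b n)⁻¹ = w n / (b n - t) := by
      have : 1 - t / b n = (b n - t) / b n := by field_simp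
      rw [this]; field_simp
    rw [← h3, ← h2]
    refine tsum_congr fun r => ?_
    rw [pow_succ', div_pow]; field_simp
  have h2 := ((Equiv.prodComm ℕ ℕ).hasSum_iff.2 h1).prod_fiberwise
    fun r => (hs.prod_symm.prod_factor r).hasSum
  convert! h2 using 2 with r
  rw [PowerSeries.coeff_mk, ← tsum_mul_right]
  rfl

end HasTaylor
end AperySeries
end

/-! ### The gamma factor and the Bell numbers C and D. -/

noncomputable section
namespace AperySeries

/-- The power series `∑_{k ≥ 2} (-1) ^ k ζ(k) t ^ k / k`. -/
def zetaSeries : PowerSeries ℂ :=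
  PowerSeries.mk fun k => if k < 2 then 0 else (-1) ^ k * riemannZeta k / k

/-- The function `log Γ(1 + t) + γ t` near `t = 0`. -/
def logGammaAux (t : ℂ) : ℂ :=
  ∑' m : ℕ, (t / (m + 1) - Complex.log (1 + t / (m + 1)))

lemma norm_div_natCast_succ_le (t : ℂ) (m : ℕ) : ‖t / ((m : ℂ) + 1)‖ ≤ ‖t‖ := by
  rw [norm_div, show ((m : ℂ) + 1) = ((m + 1 : ℕ) : ℂ) by push_cast; rfl, Complex.norm_natCast]
  exact div_le_self (norm_nonneg _) (by exact_mod_cast Nat.succ_pos m)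

lemma hasSum_sub_log_one_add {z : ℂ} (hz : ‖z‖ < 1) :
    HasSum (fun k : ℕ => if k < 2 then 0 else (-1) ^ k * z ^ k / k) (z - Complex.log (1 + z)) := by
  have h := Complex.hasSum_taylorSeries_log hz
  have h1 : HasSum (fun k : ℕ => if k = 1 then z else 0) z := by
    simpa using hasSum_ite_eq (1 : ℕ) z
  convert! h1.sub h using 2 with k
  rcases k with _ | _ | k
  · simp
  · simp
  · rw [if_neg (by omega), if_neg (by omega), pow_succ (-1 : ℂ) (k + 1 + 1)]
    ring

lemma tsum_one_div_succ_pow {k : ℕ} (hk : 2 ≤ k) :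
    ∑' m : ℕ, 1 / ((m : ℂ) + 1) ^ k = riemannZeta k := by
  rw [zeta_eq_tsum_one_div_nat_add_one_cpow (by simpa using (by omega : 1 < k))]
  exact tsum_congr fun m => by rw [Complex.cpow_natCast]

/-- The terms of the double series for `log Γ(1 + t) + γ t`. -/
def logGammaTerm (t : ℂ) (p : ℕ × ℕ) : ℂ :=
  if p.2 < 2 then 0 else (-1) ^ p.2 * (t / ((p.1 : ℂ) + 1)) ^ p.2 / (p.2 : ℂ)

lemma summable_log_double {t : ℂ} (ht : ‖t‖ < 1) :
    Summable (logGammaTerm t) := by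
  have h1 : Summable fun m : ℕ => 1 / ((m : ℝ) + 1) ^ 2 := by
    have := (summable_nat_add_iff 1).2 (Real.summable_one_div_nat_pow.2 (by norm_num : 1 < 2))
    simpa using this
  have hg := summable_geometric_of_lt_one (norm_nonneg t) ht
  refine Summable.of_norm_bounded (h1.mul_of_nonneg hg (fun n => by positivity)
      (fun n => by positivity)) fun p => ?_
  rw [logGammaTerm]
  split_ifs with hp
  · rw [norm_zero]; positivity
  · have hp1 : (1 : ℝ) ≤ p.2 := by exact_mod_cast (by omega : 1 ≤ p.2)
    have hm : (1 : ℝ) ≤ (p.1 : ℝ) + 1 := by linarith [(Nat.cast_nonneg p.1 : (0 : ℝ) ≤ p.1)]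
    rw [norm_div, norm_mul, norm_pow, norm_pow, norm_neg, norm_one, one_pow, one_mul, norm_div,
      Complex.norm_natCast, show ((p.1 : ℂ) + 1) = ((p.1 + 1 : ℕ) : ℂ) by push_cast; rfl,
      Complex.norm_natCast]
    push_cast
    refine (div_le_self (by positivity) hp1).trans ?_
    rw [div_pow, div_eq_mul_one_div, mul_comm]
    gcongr
    omega

lemma hasSum_logGammaTerm_fst {t : ℂ} (ht : ‖t‖ < 1) (m : ℕ) :
    HasSum (fun k => logGammaTerm t (m, k)) (t / ((m : ℂ) + 1) - Complex.log (1 + t / (m + 1))) := by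
  simp only [logGammaTerm]
  exact hasSum_sub_log_one_add ((norm_div_natCast_succ_le t m).trans_lt ht)

lemma tsum_logGammaTerm_snd (t : ℂ) (k : ℕ) :
    ∑' m : ℕ, logGammaTerm t (m, k) = PowerSeries.coeff k zetaSeries * t ^ k := by
  rw [zetaSeries, PowerSeries.coeff_mk]
  by_cases hk : k < 2
  · simp [logGammaTerm, hk]
  · simp only [logGammaTerm, if_neg hk]
    rw [← tsum_one_div_succ_pow (by omega), ← tsum_mul_left, ← tsum_div_const, ← tsum_mul_right]
    exact tsum_congr fun m => by rw [div_pow]; ring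

lemma hasSum_tsum_logGammaTerm {t : ℂ} (ht : ‖t‖ < 1) :
    HasSum (fun m : ℕ => t / ((m : ℂ) + 1) - Complex.log (1 + t / (m + 1)))
      (∑' p, logGammaTerm t p) :=
  (summable_log_double ht).hasSum.prod_fiberwise (hasSum_logGammaTerm_fst ht)

lemma hasSum_logGammaAux {t : ℂ} (ht : ‖t‖ < 1) :
    HasSum (fun m : ℕ => t / ((m : ℂ) + 1) - Complex.log (1 + t / (m + 1))) (logGammaAux t) := by
  exact (hasSum_tsum_logGammaTerm ht).summable.hasSum

lemma hasSum_logGammaAux_coeff {t : ℂ} (ht : ‖t‖ < 1) :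
    HasSum (fun k : ℕ => PowerSeries.coeff k zetaSeries * t ^ k) (logGammaAux t) := by
  have hs := summable_log_double ht
  rw [(hasSum_logGammaAux ht).unique (hasSum_tsum_logGammaTerm ht)]
  have h2 := ((Equiv.prodComm ℕ ℕ).hasSum_iff.2 hs.hasSum).prod_fiberwise
      fun r => (hs.prod_symm.prod_factor r).hasSum
  exact (funext fun k => tsum_logGammaTerm_snd t k) ▸ h2

lemma hasTaylor_logGammaAux : HasTaylor logGammaAux zetaSeries := by
  filter_upwards [Metric.ball_mem_nhds (0 : ℂ) one_pos] with t ht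
  exact hasSum_logGammaAux_coeff (mem_ball_zero_iff.1 ht)

/-- The partial sums are the Bohr–Mollerup approximations to log Γ(t), plus log t, plus t (H_n - log
n), whose last factor tends to γ. -/
lemma exp_logGammaAux {t : ℝ} (h0 : 0 < t) (h1 : t < 1) :
    Complex.exp (logGammaAux t) =
      Complex.Gamma (1 + t) * Complex.exp (Real.eulerMascheroniConstant * t) := by
  have ht : ‖(t : ℂ)‖ < 1 := by rwa [Complex.norm_real, Real.norm_of_nonneg h0.le]
  have hA := (hasSum_logGammaAux ht).tendsto_sum_nat
  have hG := Real.BohrMollerup.tendsto_log_gamma h0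
  have hh := Real.tendsto_harmonic_sub_log
  have hlim : Tendsto (fun n : ℕ => Real.BohrMollerup.logGammaSeq t n + Real.log t +
      t * ((harmonic n : ℝ) - Real.log n)) atTop
      (𝓝 (Real.log (Real.Gamma t) + Real.log t + t * Real.eulerMascheroniConstant)) :=
    (hG.add_const _).add (hh.const_mul t)
  have heq : ∀ n : ℕ, ∑ m ∈ Finset.range n, ((t : ℂ) / ((m : ℂ) + 1) -
      Complex.log (1 + t / (m + 1))) = ((Real.BohrMollerup.logGammaSeq t n + Real.log t +
      t * ((harmonic n : ℝ) - Real.log n) : ℝ) : ℂ) := by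
    intro n
    have hterm : ∀ m : ℕ, (t : ℂ) / ((m : ℂ) + 1) - Complex.log (1 + t / (m + 1)) =
        ((t * ((m : ℝ) + 1)⁻¹ - (Real.log (t + (m + 1 : ℕ)) - Real.log ((m : ℝ) + 1)) : ℝ) : ℂ) := by
      intro m
      have hm : (0 : ℝ) < (m : ℝ) + 1 := by positivity
      have e : Real.log (t + (m + 1 : ℕ)) - Real.log ((m : ℝ) + 1) = Real.log (1 + t / (m + 1)) := by
        rw [← Real.log_div (by positivity) hm.ne']
        congr 1; push_cast; field_simp; ring
      rw [e, Complex.ofReal_sub, Complex.ofReal_log (by positivity)]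
      push_cast; ring
    rw [Finset.sum_congr rfl fun m _ => hterm m, ← Complex.ofReal_sum]
    congr 1
    rw [Finset.sum_sub_distrib, Finset.sum_sub_distrib, ← Finset.mul_sum,
      Real.BohrMollerup.logGammaSeq, Finset.sum_range_succ']
    have hharm : ∑ m ∈ Finset.range n, ((m : ℝ) + 1)⁻¹ = (harmonic n : ℝ) := by
      simp [harmonic]
    have hfact : ∑ m ∈ Finset.range n, Real.log ((m : ℝ) + 1) = Real.log (n.factorial : ℝ) := by
      rw [← Real.log_prod fun m _ => by positivity]
      congr 1
      rw [← Finset.prod_range_add_one_eq_factorial]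
      push_cast; rfl
    rw [hharm, hfact]
    simp only [Nat.cast_zero, add_zero]
    ring
  simp only [heq] at hA
  have hlimC := (Complex.continuous_ofReal.tendsto _).comp hlim
  have hval := tendsto_nhds_unique hA hlimC
  have hGt := Real.Gamma_pos_of_pos h0
  rw [hval, show (1 + (t : ℂ)) = ((t + 1 : ℝ) : ℂ) by push_cast; ring, Complex.Gamma_ofReal,
    Real.Gamma_add_one h0.ne']
  push_cast
  rw [Complex.exp_add, Complex.exp_add, ← Complex.ofReal_exp, ← Complex.ofReal_exp,
    Real.exp_log hGt, Real.exp_log h0]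
  ring_nf

/-- `Γ(1 + t) ^ 2 4 ^ t / Γ(1 + 2 t)` near `t = 0`. -/
def gammaRatio (t : ℂ) : ℂ :=
  Complex.exp (logGammaAux t) * Complex.exp (logGammaAux t) * Complex.exp (-logGammaAux (2 * t)) *
    Complex.exp (2 * Real.log 2 * t)

/-- Legendre duplication at t + 1/2. Euler's constant drops out because the two copies of γ t cancel
the single γ · 2t. -/
lemma gammaRatio_ofReal {t : ℝ} (h0 : 0 < t) (h1 : t < 1 / 2) :
    gammaRatio t = Complex.Gamma (1 + t) * (Real.sqrt Real.pi : ℂ) / Complex.Gamma (t + 1 / 2) := by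
  have e2 := exp_logGammaAux (t := 2 * t) (by linarith) (by linarith)
  have hdup := Complex.Gamma_mul_Gamma_add_half (t + 1 / 2)
  have hne : Complex.Gamma ((t : ℂ) + 1 / 2) ≠ 0 := by
    apply Complex.Gamma_ne_zero_of_re_pos; simp; linarith
  have hne2 : Complex.Gamma (1 + ((2 * t : ℝ) : ℂ)) ≠ 0 := by
    apply Complex.Gamma_ne_zero_of_re_pos; simp; linarith
  rw [gammaRatio, exp_logGammaAux h0 (by linarith), Complex.exp_neg,
    show (2 * (t : ℂ)) = ((2 * t : ℝ) : ℂ) by push_cast; rfl, e2]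
  rw [show (t : ℂ) + 1 / 2 + 1 / 2 = 1 + t by ring,
    show 2 * ((t : ℂ) + 1 / 2) = 1 + ((2 * t : ℝ) : ℂ) by push_cast; ring] at hdup
  have hcp : (2 : ℂ) ^ (1 - (1 + ((2 * t : ℝ) : ℂ))) = (Complex.exp (2 * Real.log 2 * t))⁻¹ := by
    rw [Complex.cpow_def_of_ne_zero two_ne_zero, ← Complex.exp_neg,
      show (2 : ℂ) = ((2 : ℝ) : ℂ) by norm_num, ← Complex.ofReal_log (by norm_num)]
    congr 1; push_cast; ring
  rw [hcp] at hdup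
  have hee : Complex.exp (Real.eulerMascheroniConstant * ((2 * t : ℝ) : ℂ)) =
      Complex.exp (Real.eulerMascheroniConstant * t) * Complex.exp (Real.eulerMascheroniConstant * t) := by
    rw [← Complex.exp_add]; congr 1; push_cast; ring
  rw [hee]
  have := Complex.exp_ne_zero ((Real.eulerMascheroniConstant : ℂ) * t)
  have hE := Complex.exp_ne_zero (2 * (Real.log 2 : ℂ) * t)
  generalize Complex.Gamma ((t : ℂ) + 1 / 2) = G at *
  field_simp at hdup ⊢
  linear_combination (Complex.Gamma (1 + t)) * hdup

lemma egf_bellC : egf (fun k => if k = 1 then 0 else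
    (-1) ^ k * ((k - 1).factorial : ℂ) * riemannZeta k) = zetaSeries := by
  ext k
  rw [egf, zetaSeries, PowerSeries.coeff_mk, PowerSeries.coeff_mk]
  rcases k with _ | _ | k
  · simp
  · simp
  · rw [if_neg (by omega), if_neg (by omega), if_neg (by omega), Nat.factorial_succ (k + 1)]
    have : ((k + 1).factorial : ℂ) ≠ 0 := by exact_mod_cast Nat.factorial_ne_zero _
    have : ((k : ℂ) + 1 + 1) ≠ 0 := by exact_mod_cast Nat.succ_ne_zero (k + 1)
    push_cast
    field_simp

lemma egf_bellD : egf (fun k => if k = 1 then 0 else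
    (-1) ^ (k - 1) * ((k - 1).factorial : ℂ) * riemannZeta k) = -zetaSeries := by
  rw [← egf_bellC]
  ext k
  rw [map_neg, egf, egf, PowerSeries.coeff_mk, PowerSeries.coeff_mk]
  rcases k with _ | k
  · simp
  · simp only [Nat.add_sub_cancel, pow_succ]
    split_ifs <;> ring

lemma coeff_exp_subst_zetaSeries (n : ℕ) :
    PowerSeries.coeff n ((PowerSeries.exp ℂ).subst zetaSeries) = bellC n / n.factorial := by
  rw [bellC, bellY, egf_bellC, mul_div_cancel_left₀ _ (by exact_mod_cast n.factorial_ne_zero)]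

lemma coeff_exp_subst_neg_zetaSeries (n : ℕ) :
    PowerSeries.coeff n ((PowerSeries.exp ℂ).subst (-zetaSeries)) = bellD n / n.factorial := by
  rw [bellD, bellY, egf_bellD, mul_div_cancel_left₀ _ (by exact_mod_cast n.factorial_ne_zero)]

/-- The Taylor series of `gammaRatio`. -/
def gammaRatioSeries : PowerSeries ℂ :=
  (PowerSeries.exp ℂ).subst zetaSeries * (PowerSeries.exp ℂ).subst zetaSeries *
    PowerSeries.rescale 2 ((PowerSeries.exp ℂ).subst (-zetaSeries)) *
    PowerSeries.rescale (2 * (Real.log 2 : ℂ)) (PowerSeries.exp ℂ)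

lemma hasTaylor_exp : HasTaylor Complex.exp (PowerSeries.exp ℂ) := by
  refine Eventually.of_forall fun t => ?_
  have := NormedSpace.expSeries_div_hasSum_exp t
  rw [← Complex.exp_eq_exp_ℂ] at this
  convert! this using 2 with n
  rw [PowerSeries.coeff_exp]
  simp; ring

lemma hasTaylor_gammaRatio : HasTaylor gammaRatio gammaRatioSeries := by
  have h0 : PowerSeries.constantCoeff zetaSeries = 0 := by
    rw [← PowerSeries.coeff_zero_eq_constantCoeff_apply, zetaSeries, PowerSeries.coeff_mk]; simp
  have hC := hasTaylor_logGammaAux.exp h0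
  have hD := (hasTaylor_logGammaAux.neg.exp (by simp [h0])).comp_mul 2
  exact ((hC.mul hC).mul hD).mul (hasTaylor_exp.comp_mul (2 * (Real.log 2 : ℂ)))

end AperySeries
end

/-! ### Generating functions in t and the identity between them. -/

noncomputable section
namespace AperySeries
open Complex MeasureTheory Set

lemma sum_Icc_one_eq_sum_range (f : ℕ → ℂ) (N : ℕ) :
    ∑ n ∈ Finset.Icc 1 N, f n = ∑ n ∈ Finset.range N, f (n + 1) := by
  rw [Finset.range_eq_Ico, Finset.sum_Ico_add' f 0 N 1]
  rfl

lemma seriesSum_eq {f : ℕ → ℂ} {s : ℂ}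
    (h : Tendsto (fun N : ℕ => ∑ n ∈ Finset.range N, f (n + 1)) atTop (𝓝 s)) :
    Converges f ∧ seriesSum f = s := by
  simp only [← sum_Icc_one_eq_sum_range] at h
  exact ⟨⟨s, h⟩, h.limUnder_eq⟩

lemma hurwitzTerm_succ (p : ℕ) (z : ℂ) (n : ℕ) :
    hurwitzTerm p z (1 / 2) (n + 1) = z * (z ^ n / ((n : ℂ) + 1 / 2) ^ p) := by
  rw [hurwitzTerm]
  push_cast
  rw [pow_succ', mul_div_assoc]
  congr 3; ring

lemma norm_natCast_add_half (n : ℕ) : ‖(n : ℂ) + 1 / 2‖ = (n : ℝ) + 1 / 2 := by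
  rw [show (n : ℂ) + 1 / 2 = ((n + 1 / 2 : ℝ) : ℂ) by push_cast; rfl, norm_real,
    Real.norm_of_nonneg (by positivity)]

lemma natCast_add_half_ne_zero (n : ℕ) : (n : ℂ) + 1 / 2 ≠ 0 := by
  rw [← norm_pos_iff, norm_natCast_add_half]; positivity

lemma summable_one_div_add_half_pow {p : ℕ} (hp : 2 ≤ p) :
    Summable fun n : ℕ => 1 / ((n : ℝ) + 1 / 2) ^ p := by
  have h1 : Summable fun m : ℕ => 2 ^ p * (1 / ((m : ℝ) + 1) ^ p) := by
    have := (summable_nat_add_iff 1).2 (Real.summable_one_div_nat_pow.2 (by omega : 1 < p))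
    exact (by simpa using this : Summable fun m : ℕ => 1 / ((m : ℝ) + 1) ^ p).mul_left _
  refine h1.of_nonneg_of_le (fun n => by positivity) fun n => ?_
  rw [mul_one_div, div_le_div_iff₀ (by positivity) (by positivity), one_mul, ← mul_pow]
  gcongr
  linarith [(Nat.cast_nonneg n : (0 : ℝ) ≤ n)]

lemma summable_hurwitz {p : ℕ} (hp : 2 ≤ p) {z : ℂ} (hz : ‖z‖ = 1) :
    Summable fun n : ℕ => z ^ n / ((n : ℂ) + 1 / 2) ^ p := by
  refine Summable.of_norm ((summable_one_div_add_half_pow hp).congr fun n => ?_)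
  rw [norm_div, norm_pow, norm_pow, hz, one_pow, norm_natCast_add_half]

lemma hurwitzLi_eq_tsum {p : ℕ} (hp : 2 ≤ p) {z : ℂ} (hz : ‖z‖ = 1) :
    Converges (hurwitzTerm p z (1 / 2)) ∧
      hurwitzLi p z (1 / 2) = z * ∑' n : ℕ, z ^ n / ((n : ℂ) + 1 / 2) ^ p := by
  refine seriesSum_eq ?_
  simp only [hurwitzTerm_succ, ← Finset.mul_sum]
  exact (summable_hurwitz hp hz).hasSum.tendsto_sum_nat.const_mul z

lemma hurwitzLi_one_eq {z : ℂ} (hz : ‖z‖ = 1) (hz1 : z ≠ 1) :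
    Converges (hurwitzTerm 1 z (1 / 2)) ∧
      hurwitzLi 1 z (1 / 2) = z * ∫ u in Ioo (0 : ℝ) 1, mellinKernel 1 (1 / 2) (-z) u := by
  refine seriesSum_eq ?_
  simp only [hurwitzTerm_succ, ← Finset.mul_sum, pow_one]
  have := (tendsto_sum_integral_mellinKernel_one (s := 1 / 2) (by norm_num) hz hz1).const_mul z
  push_cast at this
  exact this

/-- The combination `x Li_{k+1}(x⁻¹; 1/2) - (-1) ^ k Li_{k+1}(x; 1/2)`. -/
def bilateralCoeff (x : ℂ) (k : ℕ) : ℂ :=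
  x * hurwitzLi (k + 1) x⁻¹ (1 / 2) - (-1) ^ k * hurwitzLi (k + 1) x (1 / 2)

/-- The bilateral series `∑_{n ∈ ℤ} x ^ (-n) / (n + 1/2 - t)`. -/
def bilateralFun (x t : ℂ) : ℂ :=
  bilateralCoeff x 0 + t * ((∑' n : ℕ, (x⁻¹ ^ n / ((n : ℂ) + 1 / 2)) / (((n : ℂ) + 1 / 2) - t)) +
    ∑' n : ℕ, (-(x ^ (n + 1) / ((n : ℂ) + 1 / 2))) / (-((n : ℂ) + 1 / 2) - t))

section

variable {x : ℂ}

lemma half_le_norm_natCast_add_half (n : ℕ) : (1 / 2 : ℝ) ≤ ‖(n : ℂ) + 1 / 2‖ := by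
  rw [norm_natCast_add_half]; linarith [(Nat.cast_nonneg n : (0 : ℝ) ≤ n)]

/-- The bilateral series is not absolutely convergent. Splitting 1/(b - t) = 1/b + t/(b (b - t))
isolates the delicate part as the constant term, and the remaining sums converge absolutely for
every x on the circle. -/
lemma hasTaylor_bilateralFun (hx : ‖x‖ = 1) :
    HasTaylor (bilateralFun x) (PowerSeries.mk (bilateralCoeff x)) := by
  have hx' : ‖x⁻¹‖ = 1 := by rw [norm_inv, hx, inv_one]
  have hx0 : x ≠ 0 := by rw [← norm_pos_iff, hx]; exact one_pos
  have hs := summable_one_div_add_half_pow le_rfl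
  have h1 := HasTaylor.tsum_div_sub (w := fun n => x⁻¹ ^ n / ((n : ℂ) + 1 / 2))
    (b := fun n => (n : ℂ) + 1 / 2) one_half_pos half_le_norm_natCast_add_half
    (hs.congr fun n => by
      rw [norm_div, norm_pow, hx', one_pow, norm_natCast_add_half, div_div, sq])
  have h2 := HasTaylor.tsum_div_sub (w := fun n => -(x ^ (n + 1) / ((n : ℂ) + 1 / 2)))
    (b := fun n => -((n : ℂ) + 1 / 2)) one_half_pos
    (fun n => by rw [norm_neg]; exact half_le_norm_natCast_add_half n)
    (hs.congr fun n => by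
      rw [norm_neg, norm_neg, norm_div, norm_pow, hx, one_pow, norm_natCast_add_half, div_div, sq])
  convert! (HasTaylor.const (bilateralCoeff x 0)).add (HasTaylor.id.mul (h1.add h2)) using 1
  ext k
  rcases k with _ | k
  · simp
  · rw [PowerSeries.coeff_mk, map_add, PowerSeries.coeff_C, if_neg (by omega), zero_add,
      PowerSeries.coeff_succ_X_mul, map_add, PowerSeries.coeff_mk, PowerSeries.coeff_mk,
      bilateralCoeff, (hurwitzLi_eq_tsum (by omega) hx').2, (hurwitzLi_eq_tsum (by omega) hx).2,
      ← mul_assoc, mul_inv_cancel₀ hx0, one_mul, sub_eq_add_neg, ← tsum_mul_left, ← tsum_mul_left,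
      ← tsum_neg]
    congr 1
    · refine tsum_congr fun n => ?_
      rw [div_div, ← pow_succ']
    · refine tsum_congr fun n => ?_
      have := natCast_add_half_ne_zero n
      rw [neg_pow ((n : ℂ) + 1 / 2) (k + 1), pow_succ x n, pow_succ' ((n : ℂ) + 1 / 2) (k + 1)]
      have h3 : ((-1 : ℂ) ^ (k + 1)) * (-1) ^ (k + 1) = 1 := by rw [← mul_pow]; simp
      have h4 : ((-1 : ℂ) ^ (k + 1)) ≠ 0 := by simp
      generalize (n : ℂ) + 1 / 2 = b at *
      generalize ((-1 : ℂ) ^ (k + 1)) = e at *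
      field_simp
      linear_combination (-1 : ℂ) * h3

lemma natCast_add_half_sub_ne_zero {t : ℝ} (ht : t < 1 / 2) (n : ℕ) :
    (n : ℂ) + 1 / 2 - t ≠ 0 := by
  have : (0 : ℝ) < n + 1 / 2 - t := by linarith [(Nat.cast_nonneg n : (0 : ℝ) ≤ n)]
  rw [show (n : ℂ) + 1 / 2 - t = ((n + 1 / 2 - t : ℝ) : ℂ) by push_cast; rfl]
  exact ofReal_ne_zero.2 this.ne'

lemma natCast_add_half_add_ne_zero {t : ℝ} (ht : -(1 / 2) < t) (n : ℕ) :
    (n : ℂ) + 1 / 2 + t ≠ 0 := by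
  have : (0 : ℝ) < n + 1 / 2 + t := by linarith [(Nat.cast_nonneg n : (0 : ℝ) ≤ n)]
  rw [show (n : ℂ) + 1 / 2 + t = ((n + 1 / 2 + t : ℝ) : ℂ) by push_cast; rfl]
  exact ofReal_ne_zero.2 this.ne'

lemma summable_div_mul_sub (hx : ‖x‖ = 1) {t : ℝ} (h1 : |t| < 1 / 2) :
    Summable fun n : ℕ => x ^ n / ((n : ℂ) + 1 / 2) / ((n : ℂ) + 1 / 2 - t) := by
  have h2 := abs_lt.1 h1
  have hδ : (0 : ℝ) < 1 - 2 * |t| := by linarith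
  refine Summable.of_norm_bounded
    ((summable_one_div_add_half_pow le_rfl).mul_left (1 - 2 * |t|)⁻¹) fun n => ?_
  have hb : (0 : ℝ) < n + 1 / 2 - t := by linarith [(Nat.cast_nonneg n : (0 : ℝ) ≤ n)]
  have hn : (0 : ℝ) ≤ n := Nat.cast_nonneg n
  rw [norm_div, norm_div, norm_pow, hx, one_pow, norm_natCast_add_half,
    show (n : ℂ) + 1 / 2 - t = ((n + 1 / 2 - t : ℝ) : ℂ) by push_cast; rfl, norm_real,
    Real.norm_of_nonneg hb.le, div_div, sq, ← one_div, div_mul_div_comm, one_mul]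
  refine one_div_le_one_div_of_le (by positivity) ?_
  have : (1 - 2 * |t|) * ((n : ℝ) + 1 / 2) ≤ n + 1 / 2 - t := by
    nlinarith [le_abs_self t, abs_nonneg t]
  calc _ = ((n : ℝ) + 1 / 2) * ((1 - 2 * |t|) * ((n : ℝ) + 1 / 2)) := by ring
    _ ≤ _ := by gcongr

lemma bilateralFun_eq_add (x : ℂ) (t : ℝ) :
    bilateralFun x t = bilateralCoeff x 0 +
      t * ((∑' n : ℕ, x⁻¹ ^ n / ((n : ℂ) + 1 / 2) / ((n : ℂ) + 1 / 2 - t)) +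
        x * ∑' n : ℕ, x ^ n / ((n : ℂ) + 1 / 2) / ((n : ℂ) + 1 / 2 - ((-t : ℝ) : ℂ))) := by
  rw [bilateralFun]
  congr 3
  rw [← tsum_mul_left]
  refine tsum_congr fun n => ?_
  rw [show -((n : ℂ) + 1 / 2) - t = -((n : ℂ) + 1 / 2 - ((-t : ℝ) : ℂ)) by push_cast; ring,
    neg_div_neg_eq, pow_succ]
  ring

lemma integral_mellinKernel_one_sub (hx : ‖x‖ = 1) (hx1 : x ≠ 1) {t : ℝ} (h1 : |t| < 1 / 2) :
    ∫ u in Ioo (0 : ℝ) 1, mellinKernel 1 (1 / 2 - t) (-x) u =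
      (∫ u in Ioo (0 : ℝ) 1, mellinKernel 1 (1 / 2) (-x) u) +
        t * ∑' n : ℕ, x ^ n / ((n : ℂ) + 1 / 2) / ((n : ℂ) + 1 / 2 - t) := by
  have h2 := abs_lt.1 h1
  have hA := tendsto_sum_integral_mellinKernel_one (s := 1 / 2 - t) (by linarith) hx hx1
  have hB := (tendsto_sum_integral_mellinKernel_one (s := 1 / 2) (by norm_num) hx hx1).add
    ((summable_div_mul_sub hx h1).hasSum.tendsto_sum_nat.const_mul (t : ℂ))
  refine tendsto_nhds_unique hA (hB.congr fun N => ?_)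
  rw [Finset.mul_sum, ← Finset.sum_add_distrib]
  refine Finset.sum_congr rfl fun n _ => ?_
  have e1 := natCast_add_half_ne_zero n
  have e2 := natCast_add_half_sub_ne_zero h2.2 n
  push_cast
  rw [← add_sub_assoc, div_div, mul_div_assoc', div_add_div _ _ e1 (mul_ne_zero e1 e2),
    div_eq_div_iff (mul_ne_zero e1 (mul_ne_zero e1 e2)) e2]
  ring

/-- The folded Mellin transform with b = 1, s = 1/2 + t and c = -x, multiplied by -x. -/
lemma bilateralFun_eq_betaIntegral (hx : ‖x‖ = 1) (hx1 : x ≠ 1) {t : ℝ} (h1 : |t| < 1 / 2) :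
    bilateralFun x t = (-x) ^ (1 / 2 - t : ℂ) *
      betaIntegral ((1 / 2 + t : ℝ) : ℂ) ((1 / 2 - t : ℝ) : ℂ) := by
  have h2 := abs_lt.1 h1
  have hx' : ‖x⁻¹‖ = 1 := by rw [norm_inv, hx, inv_one]
  have hx1' : x⁻¹ ≠ 1 := by simpa using hx1
  have hx0 : x ≠ 0 := by rw [← norm_pos_iff, hx]; exact one_pos
  have hsl := neg_mem_slitPlane hx hx1
  have hM := integral_mellinKernel_Ioo (b := 1) (s := 1 / 2 + t) (by linarith) (by linarith) hsl
  rw [show (1 - (1 / 2 + t) : ℝ) = 1 / 2 - t by ring, ofReal_one, cpow_neg_one,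
    show (-x)⁻¹ = -x⁻¹ by rw [inv_neg], integral_mellinKernel_one_sub hx' hx1' h1,
    show (1 / 2 + t : ℝ) = 1 / 2 - (-t) by ring,
    integral_mellinKernel_one_sub hx hx1 (t := -t) (by rwa [abs_neg])] at hM
  have hc : (-x) ^ (1 / 2 - t : ℂ) = (-x) * (-x) ^ (-((1 / 2 - (-t) : ℝ) : ℂ)) := by
    nth_rw 2 [← cpow_one (-x)]
    rw [← cpow_add _ _ (neg_ne_zero.2 hx0)]
    congr 1; push_cast; ring
  rw [hc, mul_assoc, show (1 / 2 + t : ℝ) = 1 / 2 - (-t) by ring, ← hM, bilateralFun_eq_add,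
    bilateralCoeff, zero_add, (hurwitzLi_one_eq hx hx1).2, (hurwitzLi_one_eq hx' hx1').2]
  push_cast
  field_simp
  ring_nf

lemma betaIntegral_half_add_half_sub {t : ℝ} (h1 : |t| < 1 / 2) :
    betaIntegral ((1 / 2 + t : ℝ) : ℂ) ((1 / 2 - t : ℝ) : ℂ) =
      Gamma (t + 1 / 2) * Gamma (1 / 2 - t) := by
  have h2 := abs_lt.1 h1
  rw [betaIntegral_eq_Gamma_mul_div _ _ (by rw [ofReal_re]; linarith) (by rw [ofReal_re]; linarith)]
  push_cast
  rw [show (1 / 2 + (t : ℂ)) + (1 / 2 - t) = 1 by ring, Gamma_one, div_one, add_comm]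

lemma Gamma_one_half_eq_sqrt : Gamma (1 / 2) = (Real.sqrt Real.pi : ℂ) := by
  rw [show (1 / 2 : ℂ) = ((1 / 2 : ℝ) : ℂ) by push_cast; rfl, Gamma_ofReal, Real.Gamma_one_half_eq]

lemma ofReal_sqrt_pi_mul_self : (Real.sqrt Real.pi : ℂ) * Real.sqrt Real.pi = Real.pi := by
  rw [← ofReal_mul, Real.mul_self_sqrt Real.pi_pos.le]

lemma bilateralCoeff_zero (hx : ‖x‖ = 1) (hx1 : x ≠ 1) :
    bilateralCoeff x 0 = (-x) ^ (1 / 2 : ℂ) * Real.pi := by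
  have h := bilateralFun_eq_betaIntegral hx hx1 (t := 0) (by norm_num)
  rw [betaIntegral_half_add_half_sub (by norm_num)] at h
  simp only [bilateralFun, ofReal_zero, zero_mul, add_zero, sub_zero, zero_add] at h
  rw [h, Gamma_one_half_eq_sqrt, ofReal_sqrt_pi_mul_self]

/-- `∑_{n ≥ 0} binom(2n, n) x ^ (-n) / (4 ^ n (n + 1/2 - t))`. -/
def halfAperyFun (x t : ℂ) : ℂ :=
  ∑' n : ℕ, (centralCoeff n : ℂ) * x⁻¹ ^ n / ((n : ℂ) + 1 / 2 - t)

/-- `∑_{n ≥ 1} binom(2n, n) x ^ n / (4 ^ n (n + t))`. -/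
def aperyFun (x t : ℂ) : ℂ :=
  ∑' n : ℕ, (-((centralCoeff (n + 1) : ℂ) * x ^ (n + 1))) / (-((n : ℂ) + 1) - t)

lemma hasTaylor_halfAperyFun (hx : ‖x‖ = 1) : HasTaylor (halfAperyFun x)
    (PowerSeries.mk fun r => ∑' n : ℕ, (centralCoeff n : ℂ) * x⁻¹ ^ n / ((n : ℂ) + 1 / 2) ^ (r + 1)) := by
  refine HasTaylor.tsum_div_sub (w := fun n => (centralCoeff n : ℂ) * x⁻¹ ^ n)
    (b := fun n => (n : ℂ) + 1 / 2) one_half_pos half_le_norm_natCast_add_half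
    ((summable_centralCoeff_div_add one_half_pos).congr fun n => ?_)
  rw [norm_mul, norm_pow, norm_inv, hx, inv_one, one_pow, mul_one, norm_natCast_add_half, norm_real,
    Real.norm_of_nonneg (centralCoeff_pos n).le]

lemma norm_natCast_add_one (n : ℕ) : ‖(n : ℂ) + 1‖ = (n : ℝ) + 1 := by
  rw [show (n : ℂ) + 1 = ((n + 1 : ℝ) : ℂ) by push_cast; rfl, norm_real,
    Real.norm_of_nonneg (by positivity)]

lemma summable_centralCoeff_succ_div :
    Summable fun n : ℕ => centralCoeff (n + 1) / ((n : ℝ) + 1) :=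
  summable_centralCoeff_div.of_nonneg_of_le
    (fun n => div_nonneg (centralCoeff_pos _).le (by positivity))
    fun n => by gcongr; exact centralCoeff_antitone n.le_succ

lemma hasTaylor_aperyFun (hx : ‖x‖ = 1) : HasTaylor (aperyFun x)
    (PowerSeries.mk fun r => ∑' n : ℕ,
      (-((centralCoeff (n + 1) : ℂ) * x ^ (n + 1))) / (-((n : ℂ) + 1)) ^ (r + 1)) := by
  refine HasTaylor.tsum_div_sub (w := fun n => -((centralCoeff (n + 1) : ℂ) * x ^ (n + 1)))
    (b := fun n => -((n : ℂ) + 1)) one_half_pos (fun n => ?_)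
    (summable_centralCoeff_succ_div.congr fun n => ?_)
  · rw [norm_neg, norm_natCast_add_one]; linarith [(Nat.cast_nonneg n : (0 : ℝ) ≤ n)]
  · rw [norm_neg, norm_neg, norm_mul, norm_pow, hx, one_pow, mul_one, norm_natCast_add_one,
      norm_real, Real.norm_of_nonneg (centralCoeff_pos _).le]

lemma halfAperyFun_eq_integral (hx : ‖x‖ = 1) {t : ℝ} (ht : t < 1 / 2) :
    halfAperyFun x t = ∫ u in Ioo (0 : ℝ) 1, mellinKernel (1 / 2) (1 / 2 - t) (-x⁻¹) u := by
  have h := hasSum_integral_mellinKernel_half (s := 1 / 2 - t) (by linarith) (z := x⁻¹)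
    (by rw [norm_inv, hx, inv_one])
  rw [← h.tsum_eq, halfAperyFun]
  refine tsum_congr fun n => ?_
  push_cast
  rw [add_sub_assoc]

lemma aperyFun_eq_integral (hx : ‖x‖ = 1) {t : ℝ} (ht : 0 < t) :
    1 / (t : ℂ) + aperyFun x t = ∫ u in Ioo (0 : ℝ) 1, mellinKernel (1 / 2) t (-x) u := by
  have h := hasSum_integral_mellinKernel_half ht hx
  rw [← h.tsum_eq, h.summable.tsum_eq_zero_add, aperyFun]
  congr 1
  · simp [centralCoeff_zero]
  · refine tsum_congr fun n => ?_
    rw [show -((n : ℂ) + 1) - t = -((n : ℂ) + 1 + t) by ring, neg_div_neg_eq]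
    push_cast; rfl

/-- The generating function identity behind the evaluation, for `x ≠ 1`. -/
lemma generating_identity_of_ne_one (hx : ‖x‖ = 1) (hx1 : x ≠ 1) {t : ℝ} (h0 : 0 < t)
    (h1 : t < 1 / 2) :
    t * halfAperyFun x t + t * (bilateralCoeff x 0 / Real.pi * aperyFun x t) +
      bilateralCoeff x 0 / Real.pi = (Real.pi : ℂ)⁻¹ * (gammaRatio t * bilateralFun x t) := by
  have hx0 : x ≠ 0 := by rw [← norm_pos_iff, hx]; exact one_pos
  have hc0 : -x ≠ 0 := neg_ne_zero.2 hx0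
  have habs : |t| < 1 / 2 := by rwa [abs_of_pos h0]
  have ht : (t : ℂ) ≠ 0 := by exact_mod_cast h0.ne'
  have hπ : (Real.pi : ℂ) ≠ 0 := by exact_mod_cast Real.pi_ne_zero
  have hsπ : (Real.sqrt Real.pi : ℂ) ≠ 0 := by
    exact_mod_cast (Real.sqrt_pos.2 Real.pi_pos).ne'
  -- The folded transform with b = 1/2 and s = t: the inner integral contributes `aperyFun` together
  -- with its n = 0 term 1/t, the outer one `halfAperyFun`.
  have hM := integral_mellinKernel_Ioo (b := 1 / 2) h0 h1 (neg_mem_slitPlane hx hx1)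
  rw [show (-x)⁻¹ = -x⁻¹ by rw [inv_neg], ← halfAperyFun_eq_integral hx h1,
    ← aperyFun_eq_integral hx h0, betaIntegral_eq_Gamma_mul_div _ _ (by rw [ofReal_re]; linarith)
      (by rw [ofReal_re]; linarith)] at hM
  push_cast at hM
  rw [show (t : ℂ) + (1 / 2 - t) = 1 / 2 by ring, Gamma_one_half_eq_sqrt] at hM
  have hG : Gamma ((t : ℂ) + 1 / 2) ≠ 0 := by
    apply Gamma_ne_zero_of_re_pos; simp; linarith
  rw [bilateralFun_eq_betaIntegral hx hx1 habs, betaIntegral_half_add_half_sub habs,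
    gammaRatio_ofReal h0 h1, bilateralCoeff_zero hx hx1, mul_div_cancel_right₀ _ hπ,
    add_comm (1 : ℂ) t, Gamma_add_one _ ht]
  have hc1 : (-x) ^ (1 / 2 : ℂ) * (-x) ^ (-(1 / 2) : ℂ) = 1 := by
    rw [← cpow_add _ _ hc0]; simp
  have hc2 : (-x) ^ (1 / 2 - t : ℂ) = (-x) ^ (1 / 2 : ℂ) * (-x) ^ (-t : ℂ) := by
    rw [← cpow_add _ _ hc0]; congr 1
  rw [hc2]
  have hR : (Real.pi : ℂ)⁻¹ * (t * Gamma t * (Real.sqrt Real.pi : ℂ) / Gamma (t + 1 / 2) *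
      ((-x) ^ (1 / 2 : ℂ) * (-x) ^ (-t : ℂ) * (Gamma (t + 1 / 2) * Gamma (1 / 2 - t)))) =
      t * (-x) ^ (1 / 2 : ℂ) * ((-x) ^ (-t : ℂ) * (Gamma t * Gamma (1 / 2 - t) / Real.sqrt Real.pi)) := by
    generalize Gamma ((t : ℂ) + 1 / 2) = G at *
    rw [← ofReal_sqrt_pi_mul_self]
    field_simp
  rw [hR, ← hM]
  have hti : (t : ℂ) * (1 / t) = 1 := by field_simp
  linear_combination (-(t * halfAperyFun x t)) * hc1 - (-x) ^ (1 / 2 : ℂ) * hti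

end

/-- Partial fractions of the cotangent at 1/2 - t. The two ways of pairing the bilateral terms have
partial sums differing by the single term 1/(N + 1/2 - t), which tends to 0. -/
lemma bilateralFun_one {t : ℝ} (h0 : 0 < t) (h1 : t < 1 / 2) :
    bilateralFun 1 t = Real.pi * Complex.cot (Real.pi * (1 / 2 - t)) := by
  have habs : |t| < 1 / 2 := by rwa [abs_of_pos h0]
  have hz : (1 / 2 - t : ℂ) ∈ integerComplement := by
    rintro ⟨m, hm⟩
    have : (m : ℝ) = 1 / 2 - t := by
      apply ofReal_injective
      rw [ofReal_intCast, hm]; push_cast; rfl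
    have ha : (0 : ℝ) < m := by linarith
    have hb : (m : ℝ) < 1 := by linarith
    have ha' : 0 < m := by exact_mod_cast ha
    have hb' : m < 1 := by exact_mod_cast hb
    omega
  have hcot := (summable_cotTerm hz).hasSum.tendsto_sum_nat
  have hcot' := cot_series_rep' hz
  have hcs : ∑' n, cotTerm (1 / 2 - t : ℂ) n = ∑' n : ℕ, (1 / ((1 / 2 - t : ℂ) - (n + 1)) +
      1 / ((1 / 2 - t : ℂ) + (n + 1))) := rfl
  rw [hcs, ← hcot'] at hcot
  have hS1 := summable_div_mul_sub (x := 1) (by simp) habs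
  have hS2 := summable_div_mul_sub (x := 1) (by simp) (t := -t) (by rwa [abs_neg])
  have hL := ((hS1.hasSum.add hS2.hasSum).mul_left (t : ℂ)).tendsto_sum_nat
  have hval : bilateralFun 1 t = t * ((∑' n : ℕ, (1 : ℂ) ^ n / ((n : ℂ) + 1 / 2) /
      ((n : ℂ) + 1 / 2 - t)) + ∑' n : ℕ, (1 : ℂ) ^ n / ((n : ℂ) + 1 / 2) /
        ((n : ℂ) + 1 / 2 - ((-t : ℝ) : ℂ))) := by
    rw [bilateralFun_eq_add, bilateralCoeff]; simp
  rw [← hval] at hL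
  have hlim0 : Tendsto (fun N : ℕ => 1 / ((N : ℂ) + 1 / 2 - t)) atTop (𝓝 0) := by
    have hr : Tendsto (fun N : ℕ => (N : ℝ) + (1 / 2 - t)) atTop atTop :=
      tendsto_atTop_add_const_right _ _ tendsto_natCast_atTop_atTop
    have := (continuous_ofReal.tendsto _).comp hr.inv_tendsto_atTop
    rw [ofReal_zero] at this
    refine this.congr fun N => ?_
    simp only [Function.comp, Pi.inv_apply]
    rw [add_sub_assoc]
    simp
  have hR := (hcot.const_add (1 / (1 / 2 - t : ℂ))).sub hlim0
  rw [sub_zero, add_sub_cancel] at hR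
  refine tendsto_nhds_unique hL (hR.congr fun N => ?_)
  induction N with
  | zero => simp
  | succ N ih =>
    rw [Finset.sum_range_succ, Finset.sum_range_succ, ← ih]
    have e0 := natCast_add_half_ne_zero N
    have e1 := natCast_add_half_sub_ne_zero h1 N
    have e2 := natCast_add_half_add_ne_zero (t := t) (by linarith) N
    have h3 : cotTerm (1 / 2 - t : ℂ) N = -(1 / ((N : ℂ) + 1 / 2 + t)) +
        1 / (((N + 1 : ℕ) : ℂ) + 1 / 2 - t) := by
      rw [cotTerm, ← one_div_neg_eq_neg_one_div]
      push_cast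
      congr 2 <;> ring
    have h4 : (t : ℂ) * ((1 : ℂ) ^ N / ((N : ℂ) + 1 / 2) / ((N : ℂ) + 1 / 2 - t) +
        (1 : ℂ) ^ N / ((N : ℂ) + 1 / 2) / ((N : ℂ) + 1 / 2 - ((-t : ℝ) : ℂ))) =
        1 / ((N : ℂ) + 1 / 2 - t) - 1 / ((N : ℂ) + 1 / 2 + t) := by
      push_cast
      rw [one_pow, sub_neg_eq_add]
      generalize (N : ℂ) + 1 / 2 = b at *
      field_simp
      ring
    rw [h3, h4]
    ring

/-- At x = 1 the coefficient of `aperyFun` vanishes and `halfAperyFun` is the beta integral B(1/2 -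
t, 1/2). Reflection at t and at t + 1/2 matches the gamma values with tan(π t). -/
lemma generating_identity_one {t : ℝ} (h0 : 0 < t) (h1 : t < 1 / 2) :
    t * halfAperyFun 1 t + t * (bilateralCoeff 1 0 / Real.pi * aperyFun 1 t) +
      bilateralCoeff 1 0 / Real.pi = (Real.pi : ℂ)⁻¹ * (gammaRatio t * bilateralFun 1 t) := by
  -- Li_1(1; 1/2) diverges, so `hurwitzLi` has an arbitrary value there; its two occurrences cancel
  -- whatever that value is.
  have hb : bilateralCoeff 1 0 = 0 := by simp [bilateralCoeff]
  have ht : (t : ℂ) ≠ 0 := by exact_mod_cast h0.ne'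
  have hπ : (Real.pi : ℂ) ≠ 0 := by exact_mod_cast Real.pi_ne_zero
  have hI : ∫ u in Ioo (0 : ℝ) 1, mellinKernel (1 / 2) (1 / 2 - t) (-1⁻¹) u =
      betaIntegral ((1 / 2 - t : ℝ) : ℂ) ((1 / 2 : ℝ) : ℂ) := by
    rw [betaIntegral_ofReal]
    refine setIntegral_congr_fun measurableSet_Ioo fun u hu => ?_
    have hu1 : 0 < 1 - u := by linarith [hu.2]
    rw [mellinKernel, ofReal_mul, ofReal_cpow hu1.le]
    congr 2
    · push_cast; ring
    · push_cast; ring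
  have hcos : Complex.cos (Real.pi * t) ≠ 0 := by
    rw [← ofReal_mul, ← ofReal_cos]
    have := Real.cos_pos_of_mem_Ioo (x := Real.pi * t)
      ⟨by nlinarith [Real.pi_pos], by nlinarith [Real.pi_pos]⟩
    exact_mod_cast this.ne'
  have hcot : Complex.cot (Real.pi * (1 / 2 - t)) = Complex.sin (Real.pi * t) / Complex.cos (Real.pi * t) := by
    rw [Complex.cot, show (Real.pi : ℂ) * (1 / 2 - t) = Real.pi / 2 - Real.pi * t by ring,
      Complex.cos_pi_div_two_sub, Complex.sin_pi_div_two_sub]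
  have hr1 := Complex.Gamma_mul_Gamma_one_sub (t + 1 / 2)
  have hr2 := Complex.Gamma_mul_Gamma_one_sub t
  rw [show (1 : ℂ) - (t + 1 / 2) = 1 / 2 - t by ring,
    show (Real.pi : ℂ) * (t + 1 / 2) = Real.pi * t + Real.pi / 2 by ring,
    Complex.sin_add_pi_div_two] at hr1
  have hsin : Complex.sin (Real.pi * t) ≠ 0 := by
    rw [← ofReal_mul, ← ofReal_sin]
    have := Real.sin_pos_of_pos_of_lt_pi (x := Real.pi * t) (by positivity)
      (by nlinarith [Real.pi_pos])
    exact_mod_cast this.ne'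
  have hG1 : Gamma ((t : ℂ) + 1 / 2) ≠ 0 := by
    apply Gamma_ne_zero_of_re_pos; simp; linarith
  have hG2 : Gamma (1 - (t : ℂ)) ≠ 0 := by
    apply Gamma_ne_zero_of_re_pos; simp; linarith
  rw [hb, bilateralFun_one h0 h1, hcot, gammaRatio_ofReal h0 h1,
    halfAperyFun_eq_integral (by simp) h1, hI,
    betaIntegral_eq_Gamma_mul_div _ _ (by rw [ofReal_re]; linarith) (by simp)]
  push_cast
  rw [show (1 / 2 - (t : ℂ)) + 1 / 2 = 1 - t by ring, Gamma_one_half_eq_sqrt, add_comm (1 : ℂ) t,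
    Gamma_add_one _ ht]
  generalize Gamma ((t : ℂ) + 1 / 2) = G1 at *
  generalize Gamma (1 - (t : ℂ)) = G2 at *
  generalize Gamma ((1 : ℂ) / 2 - t) = G3 at *
  field_simp at hr1 hr2 ⊢
  linear_combination (t * Real.pi * Real.sqrt Real.pi : ℂ) * (hr1 - hr2)

end AperySeries
end

/-! ### Comparison of coefficients and the main theorem. -/

noncomputable section
namespace AperySeries
open Complex

variable {x : ℂ}

/-- The Taylor coefficients of the generating function identity. -/
lemma coeff_generating_identity (hx : ‖x‖ = 1) (r : ℕ) :
    (∑' n : ℕ, (centralCoeff n : ℂ) * x⁻¹ ^ n / ((n : ℂ) + 1 / 2) ^ (r + 1)) =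
      (Real.pi : ℂ)⁻¹ * PowerSeries.coeff (r + 1)
        (gammaRatioSeries * PowerSeries.mk (bilateralCoeff x)) +
      (-1) ^ (r + 1) * (bilateralCoeff x 0 / Real.pi) *
        ∑' n : ℕ, (centralCoeff (n + 1) : ℂ) * x ^ (n + 1) / ((n : ℂ) + 1) ^ (r + 1) := by
  have hL := ((HasTaylor.id.mul (hasTaylor_halfAperyFun hx)).add (HasTaylor.id.mul
    ((HasTaylor.const (bilateralCoeff x 0 / Real.pi)).mul (hasTaylor_aperyFun hx)))).add
    (HasTaylor.const (bilateralCoeff x 0 / Real.pi))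
  have hR := (HasTaylor.const (Real.pi : ℂ)⁻¹).mul
    (hasTaylor_gammaRatio.mul (hasTaylor_bilateralFun hx))
  have h := HasTaylor.eq_of_eqOn_Ioo hL hR one_half_pos fun t h0 h1 => by
    by_cases hx1 : x = 1
    · subst hx1
      exact generating_identity_one h0 h1
    · exact generating_identity_of_ne_one hx hx1 h0 h1
  have h2 := congrArg (PowerSeries.coeff (r + 1)) h
  rw [map_add, map_add, PowerSeries.coeff_succ_X_mul, PowerSeries.coeff_succ_X_mul,
    PowerSeries.coeff_C_mul, PowerSeries.coeff_C_mul, PowerSeries.coeff_mk, PowerSeries.coeff_mk,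
    PowerSeries.coeff_C, if_neg r.succ_ne_zero, add_zero] at h2
  rw [← h2]
  have h3 : ∑' n : ℕ, (-((centralCoeff (n + 1) : ℂ) * x ^ (n + 1))) / (-((n : ℂ) + 1)) ^ (r + 1) =
      -(-1) ^ (r + 1) * ∑' n : ℕ, (centralCoeff (n + 1) : ℂ) * x ^ (n + 1) / ((n : ℂ) + 1) ^ (r + 1) := by
    rw [← tsum_mul_left]
    refine tsum_congr fun n => ?_
    rw [neg_pow ((n : ℂ) + 1)]
    have he : ((-1 : ℂ) ^ (r + 1)) * (-1) ^ (r + 1) = 1 := by rw [← mul_pow]; simp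
    have he0 : ((-1 : ℂ) ^ (r + 1)) ≠ 0 := by simp
    have hn : (n : ℂ) + 1 ≠ 0 := by exact_mod_cast n.succ_ne_zero
    generalize ((-1 : ℂ) ^ (r + 1)) = e at *
    rw [div_eq_iff (mul_ne_zero he0 (pow_ne_zero _ hn))]
    have hn' := pow_ne_zero (r + 1) hn
    generalize ((n : ℂ) + 1) ^ (r + 1) = b at *
    field_simp
    linear_combination ((centralCoeff (n + 1) : ℂ) * x ^ (n + 1)) * he
  rw [h3]
  ring

/-- The recurrence (n+1) c_{n+1} = (n+1/2) c_n absorbs the numerator and lowers the exponent of n +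
1/2 by one. -/
lemma halfAperyTerm_succ (r : ℕ) (x : ℂ) (n : ℕ) :
    halfAperyTerm (r + 1) x (n + 1) = (centralCoeff n : ℂ) * x⁻¹ ^ n / ((n : ℂ) + 1 / 2) ^ r := by
  have hc : (centralCoeff (n + 1) : ℂ) * (2 * n + 2) = centralCoeff n * (2 * n + 1) := by
    exact_mod_cast congrArg (fun r : ℝ => (r : ℂ)) (centralCoeff_succ n)
  have hb := natCast_add_half_ne_zero n
  have h1 : ((2 * (n + 1)).choose (n + 1) : ℂ) / 4 ^ (n + 1) = (centralCoeff (n + 1) : ℂ) := by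
    simp [centralCoeff]
  have h2 : x ^ (1 - ((n + 1 : ℕ) : ℤ)) = x⁻¹ ^ n := by
    rw [show (1 - ((n + 1 : ℕ) : ℤ)) = -(n : ℤ) by push_cast; ring, zpow_neg, zpow_natCast, inv_pow]
  rw [halfAperyTerm, h1, h2, show ((n + 1 : ℕ) : ℂ) - 1 / 2 = n + 1 / 2 by push_cast; ring, pow_succ]
  have h3 : ((n + 1 : ℕ) : ℂ) * centralCoeff (n + 1) = centralCoeff n * (n + 1 / 2) := by
    push_cast; linear_combination hc / 2
  rw [div_mul_eq_mul_div, h3]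
  generalize (n : ℂ) + 1 / 2 = b at *
  field_simp

lemma aperyTerm_succ (r : ℕ) (x : ℂ) (n : ℕ) : aperyTerm (r + 1) x (n + 1) =
    (centralCoeff (n + 1) : ℂ) * x ^ (n + 1) / ((n : ℂ) + 1) ^ r := by
  rw [aperyTerm, Nat.add_sub_cancel, centralCoeff]
  push_cast
  rw [mul_comm (((n : ℂ) + 1) ^ r), ← div_div, div_mul_eq_mul_div]

lemma gammaRatioSeries_coeff_zero : PowerSeries.coeff 0 gammaRatioSeries = 1 := by
  rw [← hasTaylor_gammaRatio.apply_zero]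
  simp [gammaRatio, logGammaAux]

/-- The two rescalings account for the power of 2: D is taken at 2t, and 4^t = exp(2 t log 2). -/
lemma prod_coeff_eq_term (x : ℂ) (k : Fin 5 → ℕ) :
    bellC (k 0) * bellC (k 1) * bellD (k 2) * 2 ^ (k 2 + k 3)
      / (((k 0).factorial : ℂ) * ((k 1).factorial : ℂ) * ((k 2).factorial : ℂ)
        * ((k 3).factorial : ℂ))
      * ((Real.log 2 : ℂ) ^ (k 3) / (Real.pi : ℂ))
      * (x * hurwitzLi (k 4 + 1) x⁻¹ (1 / 2) - (-1) ^ (k 4) * hurwitzLi (k 4 + 1) x (1 / 2)) =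
    (Real.pi : ℂ)⁻¹ * ∏ i : Fin 5, PowerSeries.coeff (k i) ((![(PowerSeries.exp ℂ).subst zetaSeries,
      (PowerSeries.exp ℂ).subst zetaSeries,
      PowerSeries.rescale 2 ((PowerSeries.exp ℂ).subst (-zetaSeries)),
      PowerSeries.rescale (2 * (Real.log 2 : ℂ)) (PowerSeries.exp ℂ),
      PowerSeries.mk (bilateralCoeff x)] : Fin 5 → PowerSeries ℂ) i) := by
  rw [Fin.prod_univ_five]
  show _ = (Real.pi : ℂ)⁻¹ * (PowerSeries.coeff (k 0) ((PowerSeries.exp ℂ).subst zetaSeries) *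
    PowerSeries.coeff (k 1) ((PowerSeries.exp ℂ).subst zetaSeries) *
    PowerSeries.coeff (k 2) (PowerSeries.rescale 2 ((PowerSeries.exp ℂ).subst (-zetaSeries))) *
    PowerSeries.coeff (k 3) (PowerSeries.rescale (2 * (Real.log 2 : ℂ)) (PowerSeries.exp ℂ)) *
    PowerSeries.coeff (k 4) (PowerSeries.mk (bilateralCoeff x)))
  rw [coeff_exp_subst_zetaSeries, coeff_exp_subst_zetaSeries, PowerSeries.coeff_rescale,
    coeff_exp_subst_neg_zetaSeries, PowerSeries.coeff_rescale, PowerSeries.coeff_exp,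
    PowerSeries.coeff_mk, bilateralCoeff, pow_add, mul_pow]
  simp only [map_div₀, map_one, map_natCast]
  ring

lemma coeff_prod_antidiagonalTuple (m r : ℕ) (f : Fin m → PowerSeries ℂ) :
    PowerSeries.coeff r (∏ i, f i) =
      ∑ k ∈ Finset.Nat.antidiagonalTuple m r, ∏ i, PowerSeries.coeff (k i) (f i) := by
  rw [PowerSeries.coeff_prod, ← Finset.piAntidiag_univ_fin_eq_antidiagonalTuple]
  refine Finset.sum_bij' (fun l _ => ⇑l) (fun k _ => Finsupp.equivFunOnFinite.symm k) ?_ ?_ ?_ ?_ ?_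
  · intro l hl
    rw [Finset.mem_finsuppAntidiag] at hl
    simpa [Finset.mem_piAntidiag] using hl.1
  · intro k hk
    simp only [Finset.mem_piAntidiag] at hk
    simpa [Finset.mem_finsuppAntidiag] using hk.1
  · intro l _; ext; rfl
  · intro k _; rfl
  · intro l _; rfl

lemma sum_antidiagonalTuple_eq (x : ℂ) (r : ℕ) :
    (∑ k ∈ Finset.Nat.antidiagonalTuple 5 r,
      bellC (k 0) * bellC (k 1) * bellD (k 2) * 2 ^ (k 2 + k 3)
        / (((k 0).factorial : ℂ) * ((k 1).factorial : ℂ) * ((k 2).factorial : ℂ)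
          * ((k 3).factorial : ℂ))
        * ((Real.log 2 : ℂ) ^ (k 3) / (Real.pi : ℂ))
        * (x * hurwitzLi (k 4 + 1) x⁻¹ (1 / 2) - (-1) ^ (k 4) * hurwitzLi (k 4 + 1) x (1 / 2))) =
      (Real.pi : ℂ)⁻¹ * PowerSeries.coeff r
        (gammaRatioSeries * PowerSeries.mk (bilateralCoeff x)) := by
  simp only [prod_coeff_eq_term]
  rw [← Finset.mul_sum, ← coeff_prod_antidiagonalTuple, Fin.prod_univ_five]
  rfl

lemma summable_aperyTerm (hx : ‖x‖ = 1) (r : ℕ) : Summable fun n : ℕ =>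
    (centralCoeff (n + 1) : ℂ) * x ^ (n + 1) / ((n : ℂ) + 1) ^ (r + 1) := by
  refine Summable.of_norm_bounded summable_centralCoeff_succ_div fun n => ?_
  rw [norm_div, norm_mul, norm_pow, norm_pow, hx, one_pow, mul_one, norm_natCast_add_one, norm_real,
    Real.norm_of_nonneg (centralCoeff_pos _).le]
  have := (centralCoeff_pos (n + 1)).le
  gcongr
  exact le_self_pow₀ (by linarith [(Nat.cast_nonneg n : (0 : ℝ) ≤ n)]) r.succ_ne_zero

lemma summable_halfAperyTerm (hx : ‖x‖ = 1) (r : ℕ) : Summable fun n : ℕ =>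
    (centralCoeff n : ℂ) * x⁻¹ ^ n / ((n : ℂ) + 1 / 2) ^ (r + 1) := by
  refine Summable.of_norm_bounded ((summable_centralCoeff_div_add one_half_pos).mul_left (2 ^ r))
    fun n => ?_
  have hc := (centralCoeff_pos n).le
  have hn : (0 : ℝ) ≤ n := Nat.cast_nonneg n
  rw [norm_div, norm_mul, norm_pow, norm_pow, norm_inv, hx, inv_one, one_pow, mul_one,
    norm_natCast_add_half, norm_real, Real.norm_of_nonneg hc, pow_succ, mul_div_assoc',
    div_le_div_iff₀ (by positivity) (by positivity)]
  have h1 : (1 : ℝ) ≤ 2 ^ r * (n + 1 / 2) ^ r := by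
    rw [← mul_pow]; exact one_le_pow₀ (by linarith)
  have h2 : 0 ≤ centralCoeff n * ((n : ℝ) + 1 / 2) := by positivity
  calc _ ≤ centralCoeff n * ((n : ℝ) + 1 / 2) * (2 ^ r * ((n : ℝ) + 1 / 2) ^ r) :=
        le_mul_of_one_le_right h2 h1
    _ = _ := by ring

end AperySeries

end

/-- All series are sums in increasing order of `n`. The first conjuncts say that the series on the
right-hand side converge; the last one says that the series on the left-hand side converges to the
stated value. The sum over `k` runs over all `(k_1, …, k_5) = (k 0, …, k 4)` of nonnegative
integers with sum `q - 1`. For `x = 1` (so `q ≥ 2`) the differences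
`x Li_1(x⁻¹; 1/2) - Li_1(x; 1/2)` are `0`, which is the limit of the differences of the partial sums:
both occurrences of `Li_1(1; 1/2)` are the same number and cancel. -/
theorem mainTheorem3 (x : ℂ) (hx : ∃ m : ℕ, 0 < m ∧ x ^ m = 1) (q : ℕ) (hq : 1 ≤ q)
    (hqx : ¬(q = 1 ∧ x = 1)) :
    (∀ p : ℕ, 1 ≤ p → ¬(p = 1 ∧ x = 1) →
      AperySeries.Converges (AperySeries.hurwitzTerm p x (1 / 2)) ∧
      AperySeries.Converges (AperySeries.hurwitzTerm p x⁻¹ (1 / 2))) ∧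
    AperySeries.Converges (AperySeries.aperyTerm q x) ∧
    Tendsto (fun N : ℕ => ∑ n ∈ Finset.Icc 1 N, AperySeries.halfAperyTerm q x n) atTop
      (𝓝 (∑ k ∈ Finset.Nat.antidiagonalTuple 5 (q - 1),
            AperySeries.bellC (k 0) * AperySeries.bellC (k 1) * AperySeries.bellD (k 2)
                * 2 ^ (k 2 + k 3)
              / (((k 0).factorial : ℂ) * ((k 1).factorial : ℂ) * ((k 2).factorial : ℂ)
                * ((k 3).factorial : ℂ))
              * ((Real.log 2 : ℂ) ^ (k 3) / (Real.pi : ℂ))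
              * (x * AperySeries.hurwitzLi (k 4 + 1) x⁻¹ (1 / 2)
                - (-1) ^ (k 4) * AperySeries.hurwitzLi (k 4 + 1) x (1 / 2))
          + (-1) ^ q / (Real.pi : ℂ)
              * (AperySeries.hurwitzLi 1 x (1 / 2) - x * AperySeries.hurwitzLi 1 x⁻¹ (1 / 2))
              * AperySeries.seriesSum (AperySeries.aperyTerm q x))) := by
  obtain ⟨m, hm, hxm⟩ := hx
  have hnx : ‖x‖ = 1 := Complex.norm_eq_one_of_pow_eq_one hxm hm.ne'
  have hnx' : ‖x⁻¹‖ = 1 := by rw [norm_inv, hnx, inv_one]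
  obtain ⟨r, rfl⟩ : ∃ r, q = r + 1 := ⟨q - 1, by omega⟩
  refine ⟨fun p hp hpx => ?_, ?_⟩
  · rcases hp.eq_or_lt with rfl | hp
    · have hx1 : x ≠ 1 := fun h => hpx ⟨rfl, h⟩
      exact ⟨(AperySeries.hurwitzLi_one_eq hnx hx1).1,
        (AperySeries.hurwitzLi_one_eq hnx' (by simpa using hx1)).1⟩
    · exact ⟨(AperySeries.hurwitzLi_eq_tsum hp hnx).1, (AperySeries.hurwitzLi_eq_tsum hp hnx').1⟩
  rw [Nat.add_sub_cancel, AperySeries.sum_antidiagonalTuple_eq]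
  simp only [AperySeries.sum_Icc_one_eq_sum_range, AperySeries.halfAperyTerm_succ]
  have hb : AperySeries.hurwitzLi 1 x (1 / 2) - x * AperySeries.hurwitzLi 1 x⁻¹ (1 / 2) =
      -AperySeries.bilateralCoeff x 0 := by
    simp [AperySeries.bilateralCoeff]
  rw [hb]
  -- For q = 1 the generating identity says nothing: its t^0 coefficient is trivial, both binomial
  -- sums being multiplied by t. The closed forms of these sums are used instead.
  rcases r with _ | r
  · have hx1 : x ≠ 1 := fun h => hqx ⟨rfl, h⟩
    have hx1' : x⁻¹ ≠ 1 := by simpa using hx1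
    have hG := (tendsto_add_atTop_iff_nat 1).2 (AperySeries.tendsto_sum_centralCoeff hnx hx1)
    simp only [Finset.sum_range_succ' _ (_ : ℕ), pow_zero, mul_one, AperySeries.centralCoeff_zero,
      Complex.ofReal_one] at hG
    have hG' := hG.sub_const 1
    simp only [add_sub_cancel_right] at hG'
    have hS := AperySeries.seriesSum_eq (f := AperySeries.aperyTerm (0 + 1) x)
      (s := (1 - x) ^ (-(1 / 2) : ℂ) - 1)
      (by simpa only [AperySeries.aperyTerm_succ, pow_zero, div_one] using hG')
    refine ⟨hS.1, ?_⟩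
    rw [hS.2]
    simp only [pow_zero, div_one]
    convert! AperySeries.tendsto_sum_centralCoeff hnx' hx1' using 2
    have hsl := AperySeries.neg_mem_slitPlane hnx hx1
    have hc0 := Complex.slitPlane_ne_zero hsl
    -- With `w = -x` this gives (-x)^{1/2} (1 - x)^{-1/2} = (1 - x⁻¹)^{-1/2}, which is the whole
    -- case q = 1 once the -1 from the missing n = 0 term cancels the t^0 coefficient.
    have hbr := AperySeries.one_add_inv_cpow hsl (-(1 / 2))
    have hc1 : (-x) ^ (1 / 2 : ℂ) * (-x) ^ (-(1 / 2) : ℂ) = 1 := by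
      rw [← Complex.cpow_add _ _ hc0]; simp
    rw [inv_neg, ← sub_eq_add_neg, ← sub_eq_add_neg] at hbr
    rw [PowerSeries.coeff_zero_eq_constantCoeff_apply, map_mul,
      ← PowerSeries.coeff_zero_eq_constantCoeff_apply, ← PowerSeries.coeff_zero_eq_constantCoeff_apply,
      AperySeries.gammaRatioSeries_coeff_zero, PowerSeries.coeff_mk,
      AperySeries.bilateralCoeff_zero hnx hx1, hbr]
    have hπ : (Real.pi : ℂ) ≠ 0 := by exact_mod_cast Real.pi_ne_zero
    generalize (1 - x⁻¹) ^ (-(1 / 2) : ℂ) = w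
    field_simp
    linear_combination w * hc1
  · have hS := AperySeries.seriesSum_eq (f := AperySeries.aperyTerm (r + 1 + 1) x)
      (by simpa only [AperySeries.aperyTerm_succ] using
        (AperySeries.summable_aperyTerm hnx r).hasSum.tendsto_sum_nat)
    refine ⟨hS.1, ?_⟩
    rw [hS.2]
    convert! (AperySeries.summable_halfAperyTerm hnx r).hasSum.tendsto_sum_nat using 2
    rw [AperySeries.coeff_generating_identity hnx r]
    ring
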